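/- A (finite) hypergraph $H$ is a pair of a finite vertex set $V(H)$ and a set $E(H)\subseteq 2^{V(H)}$ of edges; put $\|H\| = |V(H)|+|E(H)|$. For $X\subseteq V(H)$, the hypergraph $H-X$ has the vertex set $V(H)\setminus X$ and the edge set $\{e\setminus X : e\in E(H)\}\setminus\{\emptyset\}$. A nest-set of $H$ is a non-empty set $s\subseteq V(H)$ such that $\{e\setminus s : e\in E(H),\ e\cap s\neq\emptyset\}$ is linearly ordered by $\subseteq$. For an integer $k\ge 0$, a $k$-NEO (nest-set elimination ordering) of $H$ is a finite sequence $(s_1,\dots,s_q)$ of sets of at most $k$ vertices such that, with $H_0=H$ and $H_i=H_{i-1}-s_i$, each $s_i$ is a nest-set of $H_{i-1}$ and $H_q$ is the empty hypergraph $(\emptyset,\emptyset)$. The nest-set width $\mathrm{nsw}(H)$ is the least $k$ for which $H$ has a $k$-NEO ($\infty$ if there is none, which happens only for $H=(\emptyset,\{\emptyset\})$). **Corollary 5.7.** The problem with instance a hypergraph $H$ and an integer $k\ge 0$, and with the question "is $\mathrm{nsw}(H)\le k$?", is fixed-parameter tractable when parameterized by $k$: some algorithm decides it within $f(k)\cdot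 N^{c}$ steps, where $f$ is a computable function, $c$ is a constant and $N$ is the length of the input. Moreover, there is an algorithm that, on input $(H,k)$, runs for at most $2^{O(k^2)}\cdot\mathrm{poly}(\|H\|)$ steps (to be read as $c\cdot 2^{ck^2}(\|H\|+1)^{c}$ for a constant $c$), outputs a $k$-NEO of $H$ if $\mathrm{nsw}(H)\le k$, and rejects otherwise. Here an algorithm is a program for a random access machine with unit-cost instructions (assignment, addition, truncated subtraction, halving, indexed load and store, tests and loops). Its input is the word that consists of $k$, $|V(H)|$, $|E(H)|$ and the characteristic vectors of $V(H)$ and of all edges, for arbitrary numberings of the vertices and of the edges; $N$ is the number of entries of this word. -/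

import Mathlib

universe u

/-! Nest-sets, nest-set elimination orderings and nest-set width of hypergraphs. -/

namespace Hypergraph

/-- The size `‖H‖ = |V(H)| + |E(H)|` of a finite hypergraph. -/
noncomputable def size {α : Type u} (H : Hypergraph α) : ℕ :=
  H.vertexSet.ncard + H.edgeSet.ncard

/-- The vertex induced subhypergraph `H[U]`, for `U ⊆ V(H)`: its vertex set is `U`, and its edges
are the non-empty sets `e ∩ U`. -/
def induce {α : Type u} (H : Hypergraph α) (U : Set α) : Hypergraph α where
  vertexSet := U
  edgeSet := {e ∩ U | e ∈ H.edgeSet} \ {∅}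
  subset_vertexSet_of_mem_edgeSet' := by
    rintro _ ⟨⟨e, _, rfl⟩, _⟩
    exact Set.inter_subset_right

/-- Vertex deletion `H - X = H[V(H) \ X]`. -/
def delete {α : Type u} (H : Hypergraph α) (X : Set α) : Hypergraph α :=
  H.induce (H.vertexSet \ X)

/-- The edges incident to a set `s` of vertices, that is, to a vertex in `s`. -/
def incident {α : Type u} (H : Hypergraph α) (s : Set α) : Set (Set α) :=
  {e ∈ H.edgeSet | ∃ v ∈ s, v ∈ e}

/-- A nest-set: a non-empty set `s` of vertices such that the sets `e \ s`, for the edges `e`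
incident to `s`, are linearly ordered by `⊆`. -/
def IsNestSet {α : Type u} (H : Hypergraph α) (s : Set α) : Prop :=
  s.Nonempty ∧ s ⊆ H.vertexSet ∧ IsChain (· ⊆ ·) {d : Set α | ∃ e ∈ H.incident s, d = e \ s}

/-- A nest-set elimination ordering: successive deletion of nest-sets of the current hypergraph,
down to the empty hypergraph `⊥`, which has neither vertices nor edges. -/
def IsNEO {α : Type u} : Hypergraph α → List (Set α) → Prop
  | H, [] => H = ⊥
  | H, s :: O => H.IsNestSet s ∧ (H.delete s).IsNEO O

/-- A `k`-NEO: a nest-set elimination ordering all of whose sets have at most `k` elements. -/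
def IsKNEO {α : Type u} (H : Hypergraph α) (k : ℕ) (O : List (Set α)) : Prop :=
  H.IsNEO O ∧ ∀ s ∈ O, s.encard ≤ k

/-- The nest-set width, the least `k` for which there is a `k`-NEO. (It is `⊤` if there is none
for any `k`; for finite `H` this happens only if `V(H) = ∅` and `E(H) = {∅}`.) -/
noncomputable def nsw {α : Type u} (H : Hypergraph α) : ℕ∞ :=
  sInf {w : ℕ∞ | ∃ k : ℕ, w = k ∧ ∃ O, H.IsKNEO k O}

end Hypergraph

/-! Random access machines, with structured control flow. -/

namespace RAM

/-- A program for a random access machine with registers `0, 1, 2, …` and with memory arrays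
`0, 1, 2, …`; every register and every array cell holds a natural number. The names of registers
and arrays in a program are fixed, so that a program uses finitely many of them; the position
within an array is computed at run time. -/
inductive Prog : Type
  /-- do nothing -/
  | skip
  /-- `Rx := c` -/
  | const (x c : ℕ)
  /-- `Rx := Ry` -/
  | move (x y : ℕ)
  /-- `Rx := Ry + Rz` -/
  | add (x y z : ℕ)
  /-- `Rx := max (Ry - Rz) 0` -/
  | sub (x y z : ℕ)
  /-- `Rx := ⌊Ry / 2⌋` -/
  | half (x y : ℕ)
  /-- `Rx := Aa[Ry]` -/
  | load (x a y : ℕ)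
  /-- `Aa[Rx] := Ry` -/
  | store (a x y : ℕ)
  /-- first `p`, then `q` -/
  | seq (p q : Prog)
  /-- `p` if `Rx ≠ 0`, and `q` if `Rx = 0` -/
  | cond (x : ℕ) (p q : Prog)
  /-- repeat `p` as long as `Rx ≠ 0` -/
  | loop (x : ℕ) (p : Prog)

/-- The contents of the registers and of the arrays. -/
structure State : Type where
  reg : ℕ → ℕ
  arr : ℕ → ℕ → ℕ

/-- Assign the value `c` to the register `x`. -/
def State.setReg (σ : State) (x c : ℕ) : State :=
  { σ with reg := Function.update σ.reg x c }

/-- Assign the value `c` to the cell `i` of the array `a`. -/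
def State.setArr (σ : State) (a i c : ℕ) : State :=
  { σ with arr := Function.update σ.arr a (Function.update (σ.arr a) i c) }

/-- `Runs p σ t τ`: started in the state `σ`, the program `p` halts after exactly `t` steps, in the
state `τ`. Every elementary instruction and every test is one step. There is no multiplication,
so that `t` steps lengthen the binary expansion of a number by `O(t)` bits only. -/
inductive Runs : Prog → State → ℕ → State → Prop
  | skip (σ : State) : Runs .skip σ 1 σ
  | const (x c : ℕ) (σ : State) : Runs (.const x c) σ 1 (σ.setReg x c)
  | move (x y : ℕ) (σ : State) : Runs (.move x y) σ 1 (σ.setReg x (σ.reg y))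
  | add (x y z : ℕ) (σ : State) : Runs (.add x y z) σ 1 (σ.setReg x (σ.reg y + σ.reg z))
  | sub (x y z : ℕ) (σ : State) : Runs (.sub x y z) σ 1 (σ.setReg x (σ.reg y - σ.reg z))
  | half (x y : ℕ) (σ : State) : Runs (.half x y) σ 1 (σ.setReg x (σ.reg y / 2))
  | load (x a y : ℕ) (σ : State) : Runs (.load x a y) σ 1 (σ.setReg x (σ.arr a (σ.reg y)))
  | store (a x y : ℕ) (σ : State) : Runs (.store a x y) σ 1 (σ.setArr a (σ.reg x) (σ.reg y))
  | seq {p q : Prog} {σ τ ρ : State} {t s : ℕ} :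
      Runs p σ t τ → Runs q τ s ρ → Runs (.seq p q) σ (t + s) ρ
  | cond_pos {x : ℕ} {p q : Prog} {σ τ : State} {t : ℕ} :
      σ.reg x ≠ 0 → Runs p σ t τ → Runs (.cond x p q) σ (t + 1) τ
  | cond_zero {x : ℕ} {p q : Prog} {σ τ : State} {t : ℕ} :
      σ.reg x = 0 → Runs q σ t τ → Runs (.cond x p q) σ (t + 1) τ
  | loop_done {x : ℕ} {p : Prog} {σ : State} :
      σ.reg x = 0 → Runs (.loop x p) σ 1 σ
  | loop_step {x : ℕ} {p : Prog} {σ τ ρ : State} {t s : ℕ} :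
      σ.reg x ≠ 0 → Runs p σ t τ → Runs (.loop x p) τ s ρ → Runs (.loop x p) σ (t + s + 1) ρ

/-- Programs are deterministic: the number of steps and the final state are unique. -/
theorem Runs.unique {p : Prog} {σ τ τ₂ : State} {t t₂ : ℕ}
    (h : Runs p σ t τ) (h₂ : Runs p σ t₂ τ₂) : t = t₂ ∧ τ = τ₂ := by
  induction h generalizing t₂ τ₂ with
  | seq _ _ ih1 ih2 =>
    cases h₂ with
    | seq a b =>
      obtain ⟨rfl, rfl⟩ := ih1 a
      obtain ⟨rfl, rfl⟩ := ih2 b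
      exact ⟨rfl, rfl⟩
  | cond_pos hx _ ih =>
    cases h₂ with
    | cond_pos _ a => obtain ⟨rfl, rfl⟩ := ih a; exact ⟨rfl, rfl⟩
    | cond_zero hz _ => exact absurd hz hx
  | cond_zero hx _ ih =>
    cases h₂ with
    | cond_pos hz _ => exact absurd hx hz
    | cond_zero _ a => obtain ⟨rfl, rfl⟩ := ih a; exact ⟨rfl, rfl⟩
  | loop_done hx =>
    cases h₂ with
    | loop_done _ => exact ⟨rfl, rfl⟩
    | loop_step hz _ _ => exact absurd hx hz
  | loop_step hx _ _ ih1 ih2 =>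
    cases h₂ with
    | loop_done hz => exact absurd hz hx
    | loop_step _ a b =>
      obtain ⟨rfl, rfl⟩ := ih1 a
      obtain ⟨rfl, rfl⟩ := ih2 b
      exact ⟨rfl, rfl⟩
  | _ => cases h₂; exact ⟨rfl, rfl⟩

/-- The initial state for the input word `x`: the word stands in the array `0`, its length in the
register `0`, and everything else is zero. -/
def State.init (x : List ℕ) : State where
  reg := fun r => if r = 0 then x.length else 0
  arr := fun a i => if a = 0 then x.getD i 0 else 0

/-- The output word of a final state: it stands in the array `1`, its length in the
register `1`. -/
def State.output (τ : State) : List ℕ := (List.range (τ.reg 1)).map (τ.arr 1)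

/-- On the input word `x`, the program halts after exactly `t` steps with the output word `y`. -/
def Prog.Computes (p : Prog) (x : List ℕ) (t : ℕ) (y : List ℕ) : Prop :=
  ∃ τ : State, Runs p (State.init x) t τ ∧ τ.output = y

end RAM

/-! Parameterized decision problems. -/

/-- A parameterized decision problem, with the way in which its instances are presented to a
random access machine. -/
structure ParamProblem where
  Inst : Type u
  encode : Inst → List ℕ
  param : Inst → ℕ
  Yes : Inst → Prop

/-- Fixed-parameter tractability: there are a program, a computable function `f` and a constant `c`
such that the program halts on every instance `x` after at most `f (param x) * |x| ^ c` steps,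
with output `1` if `x` is a yes-instance and with output `0` otherwise. -/
def ParamProblem.IsFPT (P : ParamProblem.{u}) : Prop :=
  ∃ (p : RAM.Prog) (f : ℕ → ℕ) (c : ℕ), Computable f ∧
    ∀ x : P.Inst, ∃ (t : ℕ) (y : List ℕ), p.Computes (P.encode x) t y ∧
      t ≤ f (P.param x) * (P.encode x).length ^ c ∧
      (P.Yes x → y = [1]) ∧ (¬ P.Yes x → y = [0])

/-! The problem of deciding whether `nsw H ≤ k`. -/

/-- An instance: a finite hypergraph `H` and a number `k`, where `H` is presented by an arbitrary
numbering of its `n` vertices and an arbitrary numbering of its `m` edges. -/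
structure NSWInstance where
  α : Type u
  H : Hypergraph α
  n : ℕ
  m : ℕ
  vert : Fin n ≃ H.vertexSet
  edge : Fin m ≃ H.edgeSet
  k : ℕ

namespace NSWInstance

open Classical in
/-- The characteristic vector of a set of vertices, in the given numbering of the vertices. -/
noncomputable def charVec (x : NSWInstance.{u}) (s : Set x.α) : List ℕ :=
  List.ofFn (fun i => if (x.vert i : x.α) ∈ s then 1 else 0)

/-- The input word of an instance: the numbers `k`, `|V(H)|`, `|E(H)|`, the characteristic vector of
`V(H)`, and the characteristic vectors of the edges, one after the other. -/
noncomputable def encode (x : NSWInstance.{u}) : List ℕ :=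
  [x.k, x.n, x.m] ++ x.charVec x.H.vertexSet ++
    (List.ofFn (fun j => x.charVec (x.edge j : Set x.α))).flatten

/-- `x.Represents w O`: the word `w` describes the sequence `O` of sets of vertices. Each set is
written as a list of its elements, closed by a `0`; the vertex with the number `i` (numbers start
at `0`) is written as `i + 1`. -/
def Represents (x : NSWInstance.{u}) (w : List ℕ) (O : List (Set x.α)) : Prop :=
  ∃ L : List (List (Fin x.n)),
    w = (L.map (fun l => l.map (fun i => (i : ℕ) + 1) ++ [0])).flatten ∧
    O = L.map (fun l => {v : x.α | ∃ i ∈ l, v = x.vert i})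

end NSWInstance

/-- The problem with the instances `(H, k)`, the parameter `k` and the question `nsw H ≤ k`. -/
noncomputable def NSWProblem : ParamProblem.{u + 1} where
  Inst := NSWInstance.{u}
  encode := NSWInstance.encode
  param := NSWInstance.k
  Yes := fun x => x.H.nsw ≤ (x.k : ℕ∞)

/-!
If `s` is a nest-set, so is what is left of `s` after the deletion of any vertices. Hence, if `H`
has a `k`-NEO, every `H - X` with a vertex has a nest-set of size at most `k`, and eliminating such
nest-sets greedily cannot get stuck.

To find one of them, start with `S = {v}`. If two edges `e` and `f` meet `S` and neither `e \ f` nor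
`f \ e` is a subset of `S`, then every nest-set that contains `S` contains one of the two
differences: branch on which one, and add it to `S`. Every branching adds a vertex, so that `2 ^ k`
words of `k` binary choices suffice for each `v`.

This search needs `for` loops up to `2 ^ k`, `|V(H)|` and `|E(H)|` only, and a program that consists
of nested `for` loops runs for a number of steps polynomial in the largest of their bounds.
-/

namespace NestSetElimination

variable {α : Type u} {H : Hypergraph α}

theorem mem_delete_edgeSet {X d : Set α} :
    d ∈ (H.delete X).edgeSet ↔ d.Nonempty ∧ ∃ e ∈ H.edgeSet, d = e \ X := by
  have inter_eq : ∀ e ∈ H.edgeSet, e ∩ (H.vertexSet \ X) = e \ X := fun e he => by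
    rw [← Set.inter_sdiff_assoc, Set.inter_eq_left.2 (H.subset_vertexSet_of_mem_edgeSet' he)]
  change (∃ e, e ∈ H.edgeSet ∧ e ∩ (H.vertexSet \ X) = d) ∧ d ≠ ∅ ↔ _
  rw [and_comm, Set.nonempty_iff_ne_empty]
  refine and_congr_right fun _ => exists_congr fun e => and_congr_right fun he => ?_
  rw [inter_eq e he, eq_comm]

theorem delete_delete (H : Hypergraph α) (X Y : Set α) :
    (H.delete X).delete Y = H.delete (X ∪ Y) := by
  refine Hypergraph.ext Set.sdiff_sdiff (Set.ext fun d => ?_)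
  simp only [mem_delete_edgeSet]
  refine and_congr_right fun hd => ⟨?_, ?_⟩
  · rintro ⟨_, ⟨-, e, he, rfl⟩, rfl⟩
    exact ⟨e, he, Set.sdiff_sdiff⟩
  · rintro ⟨e, he, rfl⟩
    exact ⟨e \ X, ⟨hd.mono (Set.sdiff_subset_sdiff_right Set.subset_union_left), e, he, rfl⟩,
      Set.sdiff_sdiff.symm⟩

theorem delete_eq_bot {X : Set α} (hX : H.vertexSet ⊆ X) : H.delete X = ⊥ := by
  refine Hypergraph.ext (Set.sdiff_eq_empty.2 hX) (Set.eq_empty_iff_forall_notMem.2 fun d hd => ?_)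
  obtain ⟨hne, e, he, rfl⟩ := mem_delete_edgeSet.1 hd
  exact hne.ne_empty (Set.sdiff_eq_empty.2 ((H.subset_vertexSet_of_mem_edgeSet' he).trans hX))

theorem isNestSet_iff {s : Set α} : H.IsNestSet s ↔ s.Nonempty ∧ s ⊆ H.vertexSet ∧
    ∀ e ∈ H.edgeSet, ∀ f ∈ H.edgeSet, (e ∩ s).Nonempty → (f ∩ s).Nonempty →
      e \ s ⊆ f ∨ f \ s ⊆ e := by
  have mem_incident : ∀ e, e ∈ H.incident s ↔ e ∈ H.edgeSet ∧ (e ∩ s).Nonempty := fun e =>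
    and_congr_right fun _ => exists_congr fun v => and_comm
  have sdiff_subset_iff : ∀ e f : Set α, e \ s ⊆ f \ s ↔ e \ s ⊆ f := fun e f =>
    ⟨fun h => h.trans Set.sdiff_subset, fun h => Set.subset_sdiff.2 ⟨h, Set.disjoint_sdiff_left⟩⟩
  refine and_congr_right fun _ => and_congr_right fun _ => ⟨fun h e he f hf hes hfs => ?_,
    fun h => ?_⟩
  · have := h.total ⟨e, (mem_incident e).2 ⟨he, hes⟩, rfl⟩ ⟨f, (mem_incident f).2 ⟨hf, hfs⟩, rfl⟩
    simpa only [sdiff_subset_iff] using this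
  · rintro _ ⟨e, he, rfl⟩ _ ⟨f, hf, rfl⟩ -
    rw [mem_incident] at he hf
    simpa only [sdiff_subset_iff] using h e he.1 f hf.1 he.2 hf.2

theorem isNestSet_delete_iff {X s : Set α} : (H.delete X).IsNestSet s ↔
    s.Nonempty ∧ s ⊆ H.vertexSet \ X ∧
    ∀ e ∈ H.edgeSet, ∀ f ∈ H.edgeSet, (e ∩ s).Nonempty → (f ∩ s).Nonempty →
      e \ (X ∪ s) ⊆ f ∨ f \ (X ∪ s) ⊆ e := by
  rw [isNestSet_iff]
  refine and_congr_right fun _ => and_congr_right fun hs => ?_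
  have inter_eq : ∀ e : Set α, e \ X ∩ s = e ∩ s := fun e => by
    rw [Set.sdiff_eq, Set.inter_right_comm, Set.inter_eq_left]
    exact Set.inter_subset_right.trans (hs.trans Set.inter_subset_right)
  have sdiff_subset_iff : ∀ e f : Set α, (e \ X) \ s ⊆ f \ X ↔ e \ (X ∪ s) ⊆ f := fun e f => by
    rw [Set.sdiff_sdiff]
    exact ⟨fun h => h.trans Set.sdiff_subset, fun h => Set.subset_sdiff.2 ⟨h,
      Set.disjoint_sdiff_left.mono_right Set.subset_union_left⟩⟩
  constructor
  · intro h e he f hf hes hfs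
    rw [← inter_eq] at hes hfs
    have := h (e \ X) (mem_delete_edgeSet.2 ⟨hes.mono Set.inter_subset_left, e, he, rfl⟩)
      (f \ X) (mem_delete_edgeSet.2 ⟨hfs.mono Set.inter_subset_left, f, hf, rfl⟩) hes hfs
    simpa only [sdiff_subset_iff] using this
  · intro h d hd d' hd' hds hds'
    obtain ⟨-, e, he, rfl⟩ := mem_delete_edgeSet.1 hd
    obtain ⟨-, f, hf, rfl⟩ := mem_delete_edgeSet.1 hd'
    rw [inter_eq] at hds hds'
    simpa only [sdiff_subset_iff] using h e he f hf hds hds'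

theorem isNestSet_delete_sdiff {s X : Set α} (h : H.IsNestSet s) (hX : (s \ X).Nonempty) :
    (H.delete X).IsNestSet (s \ X) := by
  rw [isNestSet_iff] at h
  rw [isNestSet_delete_iff]
  refine ⟨hX, Set.sdiff_subset_sdiff_left h.2.1, fun e he f hf hes hfs => ?_⟩
  have sdiff_subset : ∀ e : Set α, e \ (X ∪ s \ X) ⊆ e \ s := fun e =>
    Set.sdiff_subset_sdiff_right (by rw [Set.union_sdiff_self]; exact Set.subset_union_right)
  exact (h.2.2 e he f hf (hes.mono (Set.inter_subset_inter_right _ Set.sdiff_subset))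
    (hfs.mono (Set.inter_subset_inter_right _ Set.sdiff_subset))).imp
      (sdiff_subset e).trans (sdiff_subset f).trans

theorem exists_isNestSet_delete {k : ℕ} {O : List (Set α)} (hO : H.IsKNEO k O) {X : Set α}
    (hX : (H.vertexSet \ X).Nonempty) : ∃ s, (H.delete X).IsNestSet s ∧ s.encard ≤ k := by
  obtain ⟨hO, hk⟩ := hO
  induction O generalizing H with
  | nil =>
    rw [show H = ⊥ from hO] at hX
    obtain ⟨v, hv, -⟩ := hX
    exact absurd hv (Set.notMem_empty v)
  | cons s O ih =>
    by_cases hs : s ⊆ X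
    · have hsX : (H.delete s).delete X = H.delete X := by
        rw [delete_delete, Set.union_eq_self_of_subset_left hs]
      rw [← hsX]
      refine ih ?_ hO.2 fun t ht => hk t (List.mem_cons_of_mem _ ht)
      change ((H.vertexSet \ s) \ X).Nonempty
      rwa [Set.sdiff_sdiff, Set.union_eq_self_of_subset_left hs]
    · exact ⟨s \ X, isNestSet_delete_sdiff hO.1 (Set.sdiff_nonempty.2 hs),
        (Set.encard_le_encard Set.sdiff_subset).trans (hk s List.mem_cons_self)⟩

-- Only the empty edge distinguishes `H` from `H.delete ∅`, and no nest-set is incident to it.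
theorem isNEO_of_delete_empty {O : List (Set α)} (hO : O ≠ []) (h : (H.delete ∅).IsNEO O) :
    H.IsNEO O := by
  cases O with
  | nil => exact absurd rfl hO
  | cons s O =>
    obtain ⟨hs, hO⟩ := h
    rw [isNestSet_delete_iff, Set.empty_union, Set.sdiff_empty] at hs
    rw [delete_delete, Set.empty_union] at hO
    exact ⟨isNestSet_iff.2 hs, hO⟩

theorem nsw_le_iff {k : ℕ} : H.nsw ≤ k ↔ ∃ O, H.IsKNEO k O := by
  constructor
  · intro h
    have hne : {w : ℕ∞ | ∃ k : ℕ, w = k ∧ ∃ O, H.IsKNEO k O}.Nonempty := by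
      by_contra hne
      rw [Set.not_nonempty_iff_eq_empty] at hne
      rw [Hypergraph.nsw, hne, sInf_empty, top_le_iff] at h
      exact ENat.natCast_ne_top k h
    obtain ⟨k', hk', O, hO⟩ := csInf_mem hne
    exact ⟨O, hO.1, fun s hs => (hO.2 s hs).trans (hk'.symm.trans_le h)⟩
  · rintro ⟨O, hO⟩
    exact sInf_le ⟨k, rfl, O, hO⟩

end NestSetElimination

namespace NestSetSearch

open Finset

variable {V : Type*}

/-- A state of the search for a nest-set: the candidate set, the binary choices that have not been
used up (the least significant bit is the next one), and whether the current pass has changed the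
candidate set. -/
structure Config (V : Type*) where
  set : Finset V
  choices : ℕ
  changed : Bool

/-- From any subset of `s`, suitable binary choices let `g` lead to a subset of `s`, and at most as
many choices are used up as vertices are added. -/
def Guided (s : Finset V) (g : Config V → Config V) : Prop :=
  ∀ S ⊆ s, ∀ w, ∃ S' ⊆ s, ∃ w' l c, l + S.card ≤ S'.card ∧ c < 2 ^ l ∧
    ∀ b, g ⟨S, c + 2 ^ l * b, w⟩ = ⟨S', b, w'⟩

theorem Guided.id (s : Finset V) : Guided s id := fun S hS w =>
  ⟨S, hS, w, 0, 0, by simp, by simp, fun b => by simp⟩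

theorem Guided.comp {s : Finset V} {g₁ g₂ : Config V → Config V} (h₂ : Guided s g₂)
    (h₁ : Guided s g₁) : Guided s (g₂ ∘ g₁) := by
  intro S hS w
  obtain ⟨S₁, hS₁, w₁, l₁, c₁, hl₁, hc₁, hg₁⟩ := h₁ S hS w
  obtain ⟨S₂, hS₂, w₂, l₂, c₂, hl₂, hc₂, hg₂⟩ := h₂ S₁ hS₁ w₁
  refine ⟨S₂, hS₂, w₂, l₁ + l₂, c₁ + 2 ^ l₁ * c₂, by omega, ?_, fun b => ?_⟩
  · calc c₁ + 2 ^ l₁ * c₂ < 2 ^ l₁ + 2 ^ l₁ * c₂ := by omega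
      _ = 2 ^ l₁ * (c₂ + 1) := by ring
      _ ≤ 2 ^ l₁ * 2 ^ l₂ := Nat.mul_le_mul_left _ hc₂
      _ = _ := (pow_add _ _ _).symm
  · have : c₁ + 2 ^ l₁ * c₂ + 2 ^ (l₁ + l₂) * b = c₁ + 2 ^ l₁ * (c₂ + 2 ^ l₂ * b) := by ring
    rw [Function.comp_apply, this, hg₁, hg₂]

theorem Guided.iterate {s : Finset V} {g : Config V → Config V} (h : Guided s g) (k : ℕ) :
    Guided s g^[k] := by
  induction k with
  | zero => exact .id s
  | succ k ih => exact ih.comp h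

theorem Guided.foldl {s : Finset V} {ι : Type*} {g : Config V → ι → Config V} {l : List ι}
    (h : ∀ i ∈ l, Guided s fun c => g c i) : Guided s fun c => l.foldl g c := by
  induction l with
  | nil => exact .id s
  | cons i l ih =>
    exact (ih fun j hj => h j (List.mem_cons_of_mem i hj)).comp (h i List.mem_cons_self)

variable [DecidableEq V]

/-- In the hypergraph with the edges `E 0, E 1, …`, the edges `E e` and `E f` are both incident to
`S` and they witness that `S` is not a nest-set. -/
def Incomparable (E : ℕ → Finset V) (S : Finset V) (e f : ℕ) : Prop :=
  (E e ∩ S).Nonempty ∧ (E f ∩ S).Nonempty ∧ ¬ E e \ E f ⊆ S ∧ ¬ E f \ E e ⊆ S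

instance (E : ℕ → Finset V) (S : Finset V) (e f : ℕ) : Decidable (Incomparable E S e f) :=
  inferInstanceAs (Decidable (_ ∧ _))

/-- `S` is a nest-set of the hypergraph with the vertex set `U` and the edges
`E 0, …, E (m - 1)`. -/
def IsNest (E : ℕ → Finset V) (U : Finset V) (m : ℕ) (S : Finset V) : Prop :=
  S.Nonempty ∧ S ⊆ U ∧ ∀ e < m, ∀ f < m, ¬ Incomparable E S e f

/-- A nest-set that contains the candidate set must contain `E e \ E f` or `E f \ E e` if the two
edges are incomparable; the next binary choice tells which one. -/
def step (E : ℕ → Finset V) (c : Config V) (p : ℕ × ℕ) : Config V :=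
  if Incomparable E c.set p.1 p.2 then
    ⟨c.set ∪ if c.choices % 2 = 0 then E p.2 \ E p.1 else E p.1 \ E p.2, c.choices / 2, true⟩
  else c

/-- One pass of the search over all pairs of edges. -/
def pass (E : ℕ → Finset V) (m : ℕ) (c : Config V) : Config V :=
  (List.range m ×ˢ List.range m).foldl (step E) { c with changed := false }

/-- The search for a nest-set of size at most `k` that contains `v`, with the binary choices `b`. It
succeeds if the last pass does not change the candidate set. -/
def search (E : ℕ → Finset V) (m k : ℕ) (v : V) (b : ℕ) : Config V :=
  (pass E m)^[k] ⟨{v}, b, true⟩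

section Search

variable {E : ℕ → Finset V} {U : Finset V} {m k : ℕ}

theorem step_of_incomparable {c : Config V} {p : ℕ × ℕ} (h : Incomparable E c.set p.1 p.2) :
    (step E c p).changed = true ∧ c.set ⊂ (step E c p).set := by
  have ssubset_union : ∀ {T : Finset V}, ¬ T ⊆ c.set → c.set ⊂ c.set ∪ T := fun hT =>
    ⟨subset_union_left, fun hsub => hT (subset_union_right.trans hsub)⟩
  rw [step, if_pos h]
  refine ⟨rfl, ssubset_union ?_⟩
  split_ifs
  exacts [h.2.2.2, h.2.2.1]

theorem subset_step (c : Config V) (p : ℕ × ℕ) : c.set ⊆ (step E c p).set := by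
  by_cases h : Incomparable E c.set p.1 p.2
  · exact (step_of_incomparable h).2.subset
  · rw [step, if_neg h]

theorem step_subset (hE : ∀ e, E e ⊆ U) {c : Config V} (hc : c.set ⊆ U) (p : ℕ × ℕ) :
    (step E c p).set ⊆ U := by
  rw [step]
  split_ifs
  exacts [union_subset hc (sdiff_subset.trans (hE _)), union_subset hc (sdiff_subset.trans (hE _)),
    hc]

theorem foldl_step_of_changed {l : List (ℕ × ℕ)} {c : Config V} (hc : c.changed = true) :
    (l.foldl (step E) c).changed = true ∧ c.set ⊆ (l.foldl (step E) c).set := by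
  induction l generalizing c with
  | nil => exact ⟨hc, subset_rfl⟩
  | cons p l ih =>
    have hp : (step E c p).changed = true := by
      by_cases h : Incomparable E c.set p.1 p.2
      · exact (step_of_incomparable h).1
      · rwa [step, if_neg h]
    exact ⟨(ih hp).1, (subset_step c p).trans (ih hp).2⟩

theorem foldl_step_of_forall {l : List (ℕ × ℕ)} {c : Config V}
    (h : ∀ p ∈ l, ¬ Incomparable E c.set p.1 p.2) : l.foldl (step E) c = c := by
  induction l with
  | nil => rfl
  | cons p l ih =>
    rw [List.foldl_cons, step, if_neg (h p List.mem_cons_self)]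
    exact ih fun q hq => h q (List.mem_cons_of_mem p hq)

theorem foldl_step_of_exists {l : List (ℕ × ℕ)} {c : Config V}
    (h : ∃ p ∈ l, Incomparable E c.set p.1 p.2) :
    (l.foldl (step E) c).changed = true ∧ c.set ⊂ (l.foldl (step E) c).set := by
  induction l with
  | nil => simp at h
  | cons p l ih =>
    by_cases hp : Incomparable E c.set p.1 p.2
    · obtain ⟨hchanged, hlt⟩ := step_of_incomparable hp
      obtain ⟨hchanged', hle⟩ := foldl_step_of_changed (l := l) hchanged
      exact ⟨hchanged', hlt.trans_subset hle⟩
    · rw [List.foldl_cons, step, if_neg hp]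
      refine ih ?_
      obtain ⟨q, hq, h⟩ := h
      rcases List.mem_cons.1 hq with rfl | hq
      exacts [absurd h hp, ⟨q, hq, h⟩]

theorem pass_of_forall {c : Config V} (h : ∀ e < m, ∀ f < m, ¬ Incomparable E c.set e f) :
    pass E m c = { c with changed := false } := by
  refine foldl_step_of_forall fun p hp => ?_
  obtain ⟨he, hf⟩ := List.pair_mem_product.1 hp
  exact h _ (List.mem_range.1 he) _ (List.mem_range.1 hf)

theorem pass_of_exists {c : Config V} {e f : ℕ} (he : e < m) (hf : f < m)
    (h : Incomparable E c.set e f) : (pass E m c).changed = true ∧ c.set ⊂ (pass E m c).set :=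
  foldl_step_of_exists (c := { c with changed := false })
    ⟨(e, f), List.pair_mem_product.2 ⟨List.mem_range.2 he, List.mem_range.2 hf⟩, h⟩

theorem pass_subset (hE : ∀ e, E e ⊆ U) {c : Config V} (hc : c.set ⊆ U) :
    (pass E m c).set ⊆ U :=
  List.foldlRecOn (motive := fun c : Config V => c.set ⊆ U) _ _ hc
    fun _ hb p _ => step_subset hE hb p

theorem search_subset (hE : ∀ e, E e ⊆ U) {v : V} (hv : v ∈ U) (b : ℕ) :
    (search E m k v b).set ⊆ U :=
  Function.Iterate.rec (fun c : Config V => c.set ⊆ U)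
    (singleton_subset_iff.2 hv) (fun _ hc => pass_subset hE hc) k

theorem search_changed_or (v : V) (b : ℕ) :
    v ∈ (search E m k v b).set ∧
      (((search E m k v b).changed = false ∧
          ∀ e < m, ∀ f < m, ¬ Incomparable E (search E m k v b).set e f) ∨
        ((search E m k v b).changed = true ∧ k < (search E m k v b).set.card)) := by
  induction k with
  | zero => simp [search]
  | succ k ih =>
    obtain ⟨hv, hc⟩ := ih
    have hsucc : search E m (k + 1) v b = pass E m (search E m k v b) :=
      Function.iterate_succ_apply' _ _ _
    rw [hsucc]
    generalize search E m k v b = c at hv hc ⊢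
    by_cases hex : ∃ e < m, ∃ f < m, Incomparable E c.set e f
    · obtain ⟨e, he, f, hf, h⟩ := hex
      obtain ⟨hchanged, hlt⟩ := pass_of_exists he hf h
      have hk : k < c.set.card := (hc.resolve_left fun hc => hc.2 e he f hf h).2
      exact ⟨hlt.subset hv, Or.inr ⟨hchanged, (Nat.succ_le_of_lt hk).trans_lt (card_lt_card hlt)⟩⟩
    · push Not at hex
      rw [pass_of_forall hex]
      exact ⟨hv, Or.inl ⟨rfl, hex⟩⟩

theorem isNest_search (hE : ∀ e, E e ⊆ U) {v : V} (hv : v ∈ U) {b : ℕ}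
    (h : (search E m k v b).changed = false) : IsNest E U m (search E m k v b).set := by
  obtain ⟨hmem, hc⟩ := search_changed_or (E := E) (m := m) (k := k) v b
  refine ⟨⟨v, hmem⟩, search_subset hE hv b, ?_⟩
  rcases hc with hc | hc
  exacts [hc.2, absurd (h.symm.trans hc.1) Bool.false_ne_true]

theorem guided_step {s : Finset V} {e f : ℕ} (hs : ¬ Incomparable E s e f) :
    Guided s fun c => step E c (e, f) := by
  intro S hS w
  by_cases h : Incomparable E S e f
  · have card_lt : ∀ {T : Finset V}, ¬ T ⊆ S → 1 + S.card ≤ (S ∪ T).card := fun hT => by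
      rw [add_comm]
      exact card_lt_card ⟨subset_union_left, fun hsub => hT (subset_union_right.trans hsub)⟩
    have hnested : E e \ E f ⊆ s ∨ E f \ E e ⊆ s := by
      by_contra! hcon
      exact hs ⟨h.1.mono (inter_subset_inter_left hS), h.2.1.mono (inter_subset_inter_left hS),
        hcon.1, hcon.2⟩
    rcases hnested with hef | hfe
    · refine ⟨S ∪ E e \ E f, union_subset hS hef, true, 1, 1, card_lt h.2.2.1, by simp,
        fun b => ?_⟩
      have hdiv : (1 + 2 * b) / 2 = b := by omega
      simp [step, h, hdiv]
    · refine ⟨S ∪ E f \ E e, union_subset hS hfe, true, 1, 0, card_lt h.2.2.2, by simp,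
        fun b => ?_⟩
      simp [step, h]
  · exact ⟨S, hS, w, 0, 0, by simp, by simp, fun b => by simp [step, h]⟩

theorem guided_pass {s : Finset V} (hs : IsNest E U m s) : Guided s (pass E m) := by
  have hfoldl : Guided s fun c => (List.range m ×ˢ List.range m).foldl (step E) c := by
    refine Guided.foldl fun p hp => ?_
    obtain ⟨he, hf⟩ := List.pair_mem_product.1 hp
    exact guided_step (hs.2.2 _ (List.mem_range.1 he) _ (List.mem_range.1 hf))
  exact fun S hS _ => hfoldl S hS false

theorem exists_search_unchanged {s : Finset V} (hs : IsNest E U m s) {v : V} (hv : v ∈ s)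
    (hk : s.card ≤ k) :
    ∃ b < 2 ^ k, (search E m k v b).changed = false ∧ (search E m k v b).set.card ≤ k := by
  obtain ⟨S, hS, w, l, c, hl, hc, h⟩ :=
    (guided_pass hs).iterate k {v} (singleton_subset_iff.2 hv) true
  have hcard : S.card ≤ k := (card_le_card hS).trans hk
  rw [card_singleton] at hl
  have hsearch : search E m k v c = ⟨S, 0, w⟩ := by simpa [search] using h 0
  refine ⟨c, hc.trans_le (Nat.pow_le_pow_right two_pos (by omega)), ?_⟩
  rcases (search_changed_or (E := E) (m := m) (k := k) v c).2 with hsucc | hfail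
  · exact ⟨hsucc.1, by rwa [hsearch]⟩
  · rw [hsearch] at hfail
    exact absurd hcard hfail.2.not_ge

end Search

/-- The vertices in the sets that have been eliminated. -/
def deleted (O : List (Finset V)) : Finset V := O.foldr (· ∪ ·) ∅

/-- The edges of the hypergraph that is left after the deletion of `D`. -/
def remove (E : ℕ → Finset V) (D : Finset V) (e : ℕ) : Finset V := E e \ D

theorem incomparable_remove_iff {E : ℕ → Finset V} {D S : Finset V}
    (h : Disjoint D S) {e f : ℕ} : Incomparable (remove E D) S e f ↔
      (E e ∩ S).Nonempty ∧ (E f ∩ S).Nonempty ∧ ¬ E e \ (D ∪ S) ⊆ E f ∧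
        ¬ E f \ (D ∪ S) ⊆ E e := by
  have inter_eq : ∀ A : Finset V, A \ D ∩ S = A ∩ S := fun A => by
    rw [sdiff_inter_right_comm, sdiff_eq_self_of_disjoint (h.symm.mono_left inter_subset_right)]
  have sdiff_subset_iff : ∀ A B : Finset V, (A \ D) \ (B \ D) ⊆ S ↔ A \ (D ∪ S) ⊆ B := by
    intro A B
    simp only [subset_iff, mem_sdiff, mem_union]
    exact forall_congr' fun v => by tauto
  simp only [Incomparable, remove, inter_eq, sdiff_subset_iff]

/-- The outcome of a single search for a nest-set after the elimination of the sets in `O`, with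
a first vertex and a word of binary choices. -/
def candidate (E : ℕ → Finset V) (m k : ℕ) (O : List (Finset V)) (p : V × ℕ) : Config V :=
  search (remove E (deleted O)) m k p.1 p.2

/-- The search for a nest-set with the first vertex and the binary choices given by `p` finds a
nest-set of size at most `k`. -/
def Succeeds (E : ℕ → Finset V) (m k : ℕ) (O : List (Finset V)) (p : V × ℕ) : Prop :=
  p.1 ∉ deleted O ∧ (candidate E m k O p).changed = false ∧ (candidate E m k O p).set.card ≤ k

instance (E : ℕ → Finset V) (m k : ℕ) (O : List (Finset V)) (p : V × ℕ) :
    Decidable (Succeeds E m k O p) :=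
  inferInstanceAs (Decidable (_ ∧ _))

/-- Eliminate the nest-set that a single search finds, if it succeeds. The list `O` of the
eliminated sets has the most recent one in front. -/
def attempt (E : ℕ → Finset V) (m k : ℕ) (O : List (Finset V)) (p : V × ℕ) : List (Finset V) :=
  if Succeeds E m k O p then (candidate E m k O p).set :: O else O

/-- One round of attempts, for all first vertices and all words of `k` binary choices. -/
def sweep (E : ℕ → Finset V) (m k : ℕ) (vs : List V) (O : List (Finset V)) : List (Finset V) :=
  (vs ×ˢ List.range (2 ^ k)).foldl (attempt E m k) O

/-- As many rounds as there are vertices. -/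
def eliminate (E : ℕ → Finset V) (m k : ℕ) (vs : List V) : List (Finset V) :=
  (sweep E m k vs)^[vs.length] []

/-- The sets in `O`, the last one first, are successively eliminated as nest-sets of size at most
`k`. -/
def IsElimination (E : ℕ → Finset V) (U : Finset V) (m k : ℕ) : List (Finset V) → Prop
  | [] => True
  | S :: O => IsNest (remove E (deleted O)) (U \ deleted O) m S ∧ S.card ≤ k ∧
      IsElimination E U m k O

section Eliminate

variable {E : ℕ → Finset V} {U : Finset V} {m k : ℕ} {O : List (Finset V)}

theorem IsElimination.subset (h : IsElimination E U m k O) : ∀ S ∈ O, S ⊆ U ∧ S.card ≤ k := by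
  induction O with
  | nil => simp
  | cons S O ih =>
    rintro T hT
    rcases List.mem_cons.1 hT with rfl | hT
    exacts [⟨h.1.2.1.trans sdiff_subset, h.2.1⟩, ih h.2.2 T hT]

theorem IsElimination.deleted_subset (h : IsElimination E U m k O) : deleted O ⊆ U := by
  induction O with
  | nil => exact empty_subset U
  | cons S O ih => exact union_subset (h.1.2.1.trans sdiff_subset) (ih h.2.2)

theorem IsElimination.attempt (hE : ∀ e, E e ⊆ U) (h : IsElimination E U m k O) {p : V × ℕ}
    (hp : p.1 ∈ U) : IsElimination E U m k (attempt E m k O p) := by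
  rw [NestSetSearch.attempt]
  split_ifs with hsucc
  · exact ⟨isNest_search (fun e => sdiff_subset_sdiff (hE e) subset_rfl)
      (mem_sdiff.2 ⟨hp, hsucc.1⟩) hsucc.2.1, hsucc.2.2, h⟩
  · exact h

theorem Succeeds.ssubset {p : V × ℕ} (h : Succeeds E m k O p) :
    deleted O ⊂ deleted (attempt E m k O p) := by
  rw [attempt, if_pos h]
  refine ⟨subset_union_right, fun hsub => h.1 (hsub (mem_union_left _ ?_))⟩
  exact (search_changed_or _ _).1

theorem deleted_subset_foldl (l : List (V × ℕ)) :
    deleted O ⊆ deleted (l.foldl (attempt E m k) O) := by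
  refine List.foldlRecOn (motive := fun O' => deleted O ⊆ deleted O') _ _ subset_rfl
    fun O' hO' p _ => hO'.trans ?_
  by_cases h : Succeeds E m k O' p
  · exact h.ssubset.subset
  · rw [attempt, if_neg h]

theorem deleted_ssubset_foldl {l : List (V × ℕ)} (h : ∃ p ∈ l, Succeeds E m k O p) :
    deleted O ⊂ deleted (l.foldl (attempt E m k) O) := by
  induction l with
  | nil => simp at h
  | cons p l ih =>
    by_cases hp : Succeeds E m k O p
    · exact hp.ssubset.trans_subset (deleted_subset_foldl l)
    · rw [List.foldl_cons, attempt, if_neg hp]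
      refine ih ?_
      obtain ⟨q, hq, h⟩ := h
      rcases List.mem_cons.1 hq with rfl | hq
      exacts [absurd h hp, ⟨q, hq, h⟩]

theorem exists_succeeds {vs : List V} {s : Finset V}
    (hs : IsNest (remove E (deleted O)) (vs.toFinset \ deleted O) m s) (hk : s.card ≤ k) :
    ∃ p ∈ vs ×ˢ List.range (2 ^ k), Succeeds E m k O p := by
  obtain ⟨v, hv⟩ := hs.1
  obtain ⟨b, hb, hsearch⟩ := exists_search_unchanged hs hv hk
  have hv' := mem_sdiff.1 (hs.2.1 hv)
  exact ⟨(v, b), List.pair_mem_product.2 ⟨List.mem_toFinset.1 hv'.1, List.mem_range.2 hb⟩,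
    hv'.2, hsearch⟩

theorem IsElimination.sweep {vs : List V} (hE : ∀ e, E e ⊆ vs.toFinset)
    (h : IsElimination E vs.toFinset m k O) :
    IsElimination E vs.toFinset m k (sweep E m k vs O) :=
  List.foldlRecOn _ _ h fun _ hO _ hp =>
    hO.attempt hE (List.mem_toFinset.2 (List.pair_mem_product.1 hp).1)

theorem isElimination_eliminate {vs : List V} (hE : ∀ e, E e ⊆ vs.toFinset) :
    IsElimination E vs.toFinset m k (eliminate E m k vs) :=
  Function.Iterate.rec (IsElimination E vs.toFinset m k) (a := []) trivial
    (fun _ h => h.sweep hE) vs.length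

/-- After the elimination of the sets in `O`, there is no nest-set of size at most `k`. -/
def Stuck (E : ℕ → Finset V) (U : Finset V) (m k : ℕ) (O : List (Finset V)) : Prop :=
  ∀ s, IsNest (remove E (deleted O)) (U \ deleted O) m s → k < s.card

theorem not_succeeds_of_stuck {vs : List V} (hE : ∀ e, E e ⊆ vs.toFinset)
    (h : Stuck E vs.toFinset m k O) {p : V × ℕ} (hp : p.1 ∈ vs) : ¬ Succeeds E m k O p := by
  intro hsucc
  have hnest := isNest_search (fun e => sdiff_subset_sdiff (hE e) subset_rfl)
      (mem_sdiff.2 ⟨List.mem_toFinset.2 hp, hsucc.1⟩) hsucc.2.1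
  exact absurd hsucc.2.2 (h _ hnest).not_ge

theorem sweep_of_stuck {vs : List V} (hE : ∀ e, E e ⊆ vs.toFinset)
    (h : Stuck E vs.toFinset m k O) : sweep E m k vs O = O := by
  refine List.foldlRecOn (motive := fun O' => O' = O) _ _ rfl fun O' hO' p hp => ?_
  rw [hO', attempt, if_neg (not_succeeds_of_stuck hE h (List.pair_mem_product.1 hp).1)]

theorem stuck_or_le_card {vs : List V} (hE : ∀ e, E e ⊆ vs.toFinset) (j : ℕ) :
    Stuck E vs.toFinset m k ((sweep E m k vs)^[j] []) ∨
      j ≤ (deleted ((sweep E m k vs)^[j] [])).card := by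
  induction j with
  | zero => exact Or.inr (Nat.zero_le _)
  | succ j ih =>
    rw [Function.iterate_succ_apply']
    generalize (sweep E m k vs)^[j] [] = O at ih ⊢
    by_cases hO : Stuck E vs.toFinset m k O
    · exact Or.inl (by rwa [sweep_of_stuck hE hO])
    · have hj := ih.resolve_left hO
      simp only [Stuck, not_forall, not_lt] at hO
      obtain ⟨s, hs, hk⟩ := hO
      exact Or.inr (hj.trans_lt (card_lt_card (deleted_ssubset_foldl (exists_succeeds hs hk))))

theorem eliminate_stuck_or {vs : List V} (hE : ∀ e, E e ⊆ vs.toFinset) :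
    Stuck E vs.toFinset m k (eliminate E m k vs) ∨ deleted (eliminate E m k vs) = vs.toFinset := by
  refine (stuck_or_le_card hE vs.length).imp_right fun hcard => ?_
  exact eq_of_subset_of_card_le (isElimination_eliminate hE).deleted_subset
    ((List.toFinset_card_le vs).trans hcard)

end Eliminate

end NestSetSearch

namespace RAM.State

@[simp]
theorem reg_setReg (σ : State) (x c r : ℕ) :
    (σ.setReg x c).reg r = if r = x then c else σ.reg r := by
  simp [setReg, Function.update_apply]

@[simp]
theorem arr_setReg (σ : State) (x c : ℕ) : (σ.setReg x c).arr = σ.arr := rfl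

@[simp]
theorem reg_setArr (σ : State) (a i c : ℕ) : (σ.setArr a i c).reg = σ.reg := rfl

@[simp]
theorem arr_setArr (σ : State) (a i c b j : ℕ) :
    (σ.setArr a i c).arr b j = if b = a ∧ j = i then c else σ.arr b j := by
  simp only [setArr, Function.update_apply]
  split_ifs <;> simp_all

end RAM.State

namespace ForLang

open RAM

/-- Expressions over registers and arrays; `load a e` is the cell `e` of the array `a`. -/
inductive Expr : Type
  | var (r : ℕ)
  | const (c : ℕ)
  | add (a b : Expr)
  | sub (a b : Expr)
  | half (a : Expr)
  | load (a : ℕ) (e : Expr)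

/-- The machine state `τ` agrees with `σ` on all arrays and on the registers below `K`. -/
def Agree (K : ℕ) (σ τ : State) : Prop :=
  (∀ r < K, τ.reg r = σ.reg r) ∧ τ.arr = σ.arr

theorem Agree.trans {K : ℕ} {σ τ ρ : State} (h : Agree K σ τ) (h' : Agree K τ ρ) : Agree K σ ρ :=
  ⟨fun r hr => (h'.1 r hr).trans (h.1 r hr), h'.2.trans h.2⟩

theorem Agree.mono {K L : ℕ} (hKL : K ≤ L) {σ τ : State} (h : Agree L σ τ) : Agree K σ τ :=
  ⟨fun r hr => h.1 r (hr.trans_le hKL), h.2⟩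

theorem agree_setReg {K x : ℕ} (hx : K ≤ x) (σ : State) (c : ℕ) : Agree K σ (σ.setReg x c) :=
  ⟨fun r hr => by simp [(hr.trans_le hx).ne], rfl⟩

theorem Agree.setReg {K : ℕ} {σ τ : State} (h : Agree K σ τ) (x c : ℕ) :
    Agree K (σ.setReg x c) (τ.setReg x c) :=
  ⟨fun r hr => by simp [h.1 r hr], h.2⟩

namespace Expr

/-- The value of an expression. -/
def eval : Expr → State → ℕ
  | var r, σ => σ.reg r
  | const c, _ => c
  | add a b, σ => a.eval σ + b.eval σ
  | sub a b, σ => a.eval σ - b.eval σ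
  | half a, σ => a.eval σ / 2
  | load a e, σ => σ.arr a (e.eval σ)

/-- All registers of the expression are below `K`. -/
def regsBelow (K : ℕ) : Expr → Bool
  | var r => r < K
  | const _ => true
  | add a b => a.regsBelow K && b.regsBelow K
  | sub a b => a.regsBelow K && b.regsBelow K
  | half a => a.regsBelow K
  | load _ e => e.regsBelow K

/-- Machine code that leaves the value of the expression in the register `t`, with the registers
above `t` as scratch space. -/
def compile : Expr → ℕ → Prog
  | var r, t => .move t r
  | const c, t => .const t c
  | add a b, t => .seq (.seq (a.compile t) (b.compile (t + 1))) (.add t t (t + 1))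
  | sub a b, t => .seq (.seq (a.compile t) (b.compile (t + 1))) (.sub t t (t + 1))
  | half a, t => .seq (a.compile t) (.half t t)
  | load a e, t => .seq (e.compile t) (.load t a t)

/-- The running time of the compiled expression. -/
def cost : Expr → ℕ
  | var _ => 1
  | const _ => 1
  | add a b => a.cost + b.cost + 1
  | sub a b => a.cost + b.cost + 1
  | half a => a.cost + 1
  | load _ e => e.cost + 1

theorem runs_compile {K : ℕ} (e : Expr) (he : e.regsBelow K = true) {σ τ : State} {t : ℕ}
    (ht : K ≤ t) (h : Agree K σ τ) :
    ∃ τ', Runs (e.compile t) τ e.cost τ' ∧ Agree t τ τ' ∧ τ'.reg t = e.eval σ := by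
  induction e generalizing τ t with
  | var r =>
    simp only [regsBelow, decide_eq_true_eq] at he
    exact ⟨_, .move _ _ _, agree_setReg le_rfl _ _, by simp [h.1 r he, eval]⟩
  | const c => exact ⟨_, .const _ _ _, agree_setReg le_rfl _ _, by simp [eval]⟩
  | add a b iha ihb =>
    simp only [regsBelow, Bool.and_eq_true] at he
    obtain ⟨τ₁, r₁, h₁, v₁⟩ := iha he.1 ht h
    obtain ⟨τ₂, r₂, h₂, v₂⟩ := ihb he.2 (ht.trans t.le_succ) (h.trans (h₁.mono ht))
    refine ⟨_, .seq (.seq r₁ r₂) (.add _ _ _ _),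
      (h₁.trans (h₂.mono t.le_succ)).trans (agree_setReg le_rfl _ _), ?_⟩
    simp [h₂.1 t t.lt_succ_self, v₁, v₂, eval]
  | sub a b iha ihb =>
    simp only [regsBelow, Bool.and_eq_true] at he
    obtain ⟨τ₁, r₁, h₁, v₁⟩ := iha he.1 ht h
    obtain ⟨τ₂, r₂, h₂, v₂⟩ := ihb he.2 (ht.trans t.le_succ) (h.trans (h₁.mono ht))
    refine ⟨_, .seq (.seq r₁ r₂) (.sub _ _ _ _),
      (h₁.trans (h₂.mono t.le_succ)).trans (agree_setReg le_rfl _ _), ?_⟩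
    simp [h₂.1 t t.lt_succ_self, v₁, v₂, eval]
  | half a ih =>
    obtain ⟨τ₁, r₁, h₁, v₁⟩ := ih he ht h
    exact ⟨_, .seq r₁ (.half _ _ _), h₁.trans (agree_setReg le_rfl _ _), by simp [v₁, eval]⟩
  | load a e ih =>
    obtain ⟨τ₁, r₁, h₁, v₁⟩ := ih he ht h
    exact ⟨_, .seq r₁ (.load _ _ _ _), h₁.trans (agree_setReg le_rfl _ _),
      by simp [v₁, eval, h₁.2, h.2]⟩

/-- The truth of an expression; zero stands for false. -/
def Holds (e : Expr) (σ : State) : Prop := e.eval σ ≠ 0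

/-- The conjunction; the disjunction is `add`. -/
def and (a b : Expr) : Expr := sub a (sub a b)

/-- The negation, with the values `0` and `1`. -/
def not (a : Expr) : Expr := sub (const 1) a

@[simp]
theorem holds_var {r : ℕ} {σ : State} : (var r).Holds σ ↔ σ.reg r ≠ 0 := Iff.rfl

@[simp]
theorem holds_and {a b : Expr} {σ : State} : (and a b).Holds σ ↔ a.Holds σ ∧ b.Holds σ := by
  simp only [Holds, and, eval]
  omega

@[simp]
theorem holds_not {a : Expr} {σ : State} : (not a).Holds σ ↔ ¬ a.Holds σ := by
  simp only [Holds, not, eval]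
  omega

@[simp]
theorem holds_add {a b : Expr} {σ : State} : (add a b).Holds σ ↔ a.Holds σ ∨ b.Holds σ := by
  simp only [Holds, eval]
  omega

end Expr

/-- Commands. The command `forLt i b p` executes `p` with `i = 0, 1, …, Rb - 1`. -/
inductive Cmd : Type
  | skip
  | assign (x : ℕ) (e : Expr)
  | store (a : ℕ) (e₁ e₂ : Expr)
  | seq (p q : Cmd)
  | ite (e : Expr) (p q : Cmd)
  | forLt (i b : ℕ) (p : Cmd)

namespace Cmd

/-- The state after `j` rounds of a loop with the counter `i` and the body `f`. -/
def loopState (i : ℕ) (f : State → State) (σ : State) : ℕ → State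
  | 0 => σ.setReg i 0
  | j + 1 => (f (loopState i f σ j)).setReg i (j + 1)

/-- The effect of a command on the state. -/
def sem : Cmd → State → State
  | skip, σ => σ
  | assign x e, σ => σ.setReg x (e.eval σ)
  | store a e₁ e₂, σ => σ.setArr a (e₁.eval σ) (e₂.eval σ)
  | seq p q, σ => q.sem (p.sem σ)
  | ite e p q, σ => if e.eval σ ≠ 0 then p.sem σ else q.sem σ
  | .forLt i b p, σ => loopState i p.sem σ (σ.reg b)

theorem sem_ite_of_holds {e : Expr} {p q : Cmd} {σ : State} (h : e.Holds σ) :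
    (ite e p q).sem σ = p.sem σ := if_pos h

theorem sem_ite_of_not_holds {e : Expr} {p q : Cmd} {σ : State} (h : ¬ e.Holds σ) :
    (ite e p q).sem σ = q.sem σ := if_neg h

theorem reg_loopState_self (i : ℕ) (f : State → State) (σ : State) (j : ℕ) :
    (loopState i f σ j).reg i = j := by
  cases j <;> simp [loopState]

/-- The command may write the register `r`. -/
def writes : Cmd → ℕ → Bool
  | skip, _ => false
  | assign x _, r => x == r
  | store _ _ _, _ => false
  | seq p q, r => p.writes r || q.writes r
  | ite _ p q, r => p.writes r || q.writes r
  | .forLt i _ p, r => i == r || p.writes r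

/-- The command may write the array `a`. -/
def writesArr : Cmd → ℕ → Bool
  | skip, _ => false
  | assign _ _, _ => false
  | store a _ _, b => a == b
  | seq p q, b => p.writesArr b || q.writesArr b
  | ite _ p q, b => p.writesArr b || q.writesArr b
  | .forLt _ _ p, b => p.writesArr b

/-- `τ` agrees with `σ` on all registers and arrays that `p` does not write. -/
def Frame (p : Cmd) (σ τ : State) : Prop :=
  (∀ r, p.writes r = false → τ.reg r = σ.reg r) ∧
    ∀ a, p.writesArr a = false → τ.arr a = σ.arr a

theorem Frame.trans {p : Cmd} {σ τ ρ : State} (h : p.Frame σ τ) (h' : p.Frame τ ρ) :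
    p.Frame σ ρ :=
  ⟨fun r hr => (h'.1 r hr).trans (h.1 r hr), fun a ha => (h'.2 a ha).trans (h.2 a ha)⟩

theorem Frame.mono {p q : Cmd} (hr : ∀ r, q.writes r = false → p.writes r = false)
    (ha : ∀ a, q.writesArr a = false → p.writesArr a = false) {σ τ : State} (h : p.Frame σ τ) :
    q.Frame σ τ :=
  ⟨fun r hqr => h.1 r (hr r hqr), fun a hqa => h.2 a (ha a hqa)⟩

theorem frame_assign (x : ℕ) (e : Expr) (σ : State) (c : ℕ) :
    (assign x e).Frame σ (σ.setReg x c) := by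
  refine ⟨fun r hr => ?_, fun a _ => rfl⟩
  rw [writes, beq_eq_false_iff_ne] at hr
  simp [hr.symm]

theorem frame_store (a : ℕ) (e₁ e₂ : Expr) (σ : State) (i c : ℕ) :
    (store a e₁ e₂).Frame σ (σ.setArr a i c) := by
  refine ⟨fun r _ => rfl, fun b hb => ?_⟩
  rw [writesArr, beq_eq_false_iff_ne] at hb
  funext j
  simp [hb.symm]

theorem frame_loopState {p : Cmd} (hp : ∀ σ, p.Frame σ (p.sem σ)) (i b : ℕ) (σ : State) (j : ℕ) :
    (Cmd.forLt i b p).Frame σ (loopState i p.sem σ j) := by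
  have counter : ∀ τ c, (Cmd.forLt i b p).Frame τ (τ.setReg i c) := fun τ c =>
    (frame_assign i (.const c) τ c).mono (by simp +contextual [writes]) (by simp [writesArr])
  have body : ∀ τ, (Cmd.forLt i b p).Frame τ (p.sem τ) := fun τ =>
    (hp τ).mono (by simp [writes]) (by simp [writesArr])
  induction j with
  | zero => exact counter σ 0
  | succ j ih => exact (ih.trans (body _)).trans (counter _ _)

theorem frame_sem (p : Cmd) (σ : State) : p.Frame σ (p.sem σ) := by
  induction p generalizing σ with
  | skip => exact ⟨fun _ _ => rfl, fun _ _ => rfl⟩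
  | assign x e => exact frame_assign x e σ _
  | store a e₁ e₂ => exact frame_store a e₁ e₂ σ _ _
  | seq p q ihp ihq =>
    exact Frame.trans
      ((ihp σ).mono (by simp +contextual [writes]) (by simp +contextual [writesArr]))
      ((ihq _).mono (by simp [writes]) (by simp [writesArr]))
  | ite e p q ihp ihq =>
    rw [sem]
    split_ifs
    · exact (ihp σ).mono (by simp +contextual [writes]) (by simp +contextual [writesArr])
    · exact (ihq σ).mono (by simp [writes]) (by simp [writesArr])
  | forLt i b p ih => exact frame_loopState ih i b σ _

/-- All registers are below `K`, those in `R` are never written, and the loops are bounded by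
registers in `R` and leave their counters alone. -/
def wf (K : ℕ) (R : List ℕ) : Cmd → Bool
  | skip => true
  | assign x e => decide (x < K) && decide (x ∉ R) && e.regsBelow K
  | store _ e₁ e₂ => e₁.regsBelow K && e₂.regsBelow K
  | seq p q => p.wf K R && q.wf K R
  | ite e p q => e.regsBelow K && p.wf K R && q.wf K R
  | .forLt i b p => decide (i < K) && decide (i ∉ R) && decide (b < K) && decide (b ∈ R) &&
      !p.writes i && p.wf K R

theorem wf.writes {K : ℕ} {R : List ℕ} {p : Cmd} (h : p.wf K R = true) {r : ℕ} (hr : r ∈ R) :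
    p.writes r = false := by
  induction p with
  | skip => rfl
  | assign x e =>
    simp only [wf, Bool.and_eq_true, decide_eq_true_eq] at h
    exact beq_eq_false_iff_ne.2 (ne_of_mem_of_not_mem hr h.1.2).symm
  | store a e₁ e₂ => rfl
  | seq p q ihp ihq =>
    simp only [wf, Bool.and_eq_true] at h
    simp [Cmd.writes, ihp h.1, ihq h.2]
  | ite e p q ihp ihq =>
    simp only [wf, Bool.and_eq_true] at h
    simp [Cmd.writes, ihp h.1.2, ihq h.2]
  | forLt i b p ih =>
    simp only [wf, Bool.and_eq_true, decide_eq_true_eq] at h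
    simp [Cmd.writes, ih h.2, (ne_of_mem_of_not_mem hr h.1.1.1.1.2).symm]

/-- Machine code for the body `p` of a loop and the update of its counter `i` and of the number `RK`
of remaining rounds. -/
def compileRound (K i b : ℕ) (p : Prog) : Prog :=
  .seq (.seq (.seq p (.const K 1)) (.add i i K)) (.sub K b i)

/-- Machine code for a command, with the registers from `K` on as scratch space. -/
def compile (K : ℕ) : Cmd → Prog
  | skip => .skip
  | assign x e => .seq (e.compile K) (.move x K)
  | store a e₁ e₂ => .seq (.seq (e₁.compile K) (e₂.compile (K + 1))) (.store a K (K + 1))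
  | seq p q => .seq (p.compile K) (q.compile K)
  | ite e p q => .seq (e.compile K) (.cond K (p.compile K) (q.compile K))
  | .forLt i b p =>
    .seq (.seq (.const i 0) (.sub K b i)) (.loop K (compileRound K i b (p.compile K)))

/-- A bound for the running time if all loop bounds are at most `B`. -/
def cost (B : ℕ) : Cmd → ℕ
  | skip => 1
  | assign _ e => e.cost + 1
  | store _ e₁ e₂ => e₁.cost + e₂.cost + 1
  | seq p q => p.cost B + q.cost B
  | ite e p q => e.cost + (p.cost B + q.cost B + 1)
  | .forLt _ _ p => B * (p.cost B + 4) + 3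

/-- The function has polynomial growth. -/
def PolyBounded (f : ℕ → ℕ) : Prop := ∃ C d : ℕ, ∀ B, f B ≤ C * (B + 1) ^ d

theorem PolyBounded.const (c : ℕ) : PolyBounded fun _ => c := ⟨c, 0, by simp⟩

theorem PolyBounded.add {f g : ℕ → ℕ} (hf : PolyBounded f) (hg : PolyBounded g) :
    PolyBounded fun B => f B + g B := by
  obtain ⟨C, d, hf⟩ := hf
  obtain ⟨C', d', hg⟩ := hg
  refine ⟨C + C', d + d', fun B => ?_⟩
  calc f B + g B ≤ C * (B + 1) ^ d + C' * (B + 1) ^ d' := add_le_add (hf B) (hg B)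
    _ ≤ C * (B + 1) ^ (d + d') + C' * (B + 1) ^ (d + d') := by gcongr <;> omega
    _ = (C + C') * (B + 1) ^ (d + d') := (add_mul _ _ _).symm

theorem PolyBounded.id_mul {f : ℕ → ℕ} (hf : PolyBounded f) : PolyBounded fun B => B * f B := by
  obtain ⟨C, d, hf⟩ := hf
  refine ⟨C, d + 1, fun B => ?_⟩
  calc B * f B ≤ (B + 1) * (C * (B + 1) ^ d) := Nat.mul_le_mul B.le_succ (hf B)
    _ = C * (B + 1) ^ (d + 1) := by ring

theorem PolyBounded.exists_le_two_pow_mul {f : ℕ → ℕ} (hf : PolyBounded f) :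
    ∃ c, ∀ k s, f (2 ^ k + s) ≤ c * 2 ^ (c * k) * (s + 1) ^ c := by
  obtain ⟨C, d, hf⟩ := hf
  refine ⟨C * 2 ^ d + d, fun k s => ?_⟩
  have one_le := Nat.one_le_two_pow (n := k)
  calc f (2 ^ k + s) ≤ C * (2 ^ k + s + 1) ^ d := hf _
    _ ≤ C * (2 * 2 ^ k * (s + 1)) ^ d := by gcongr; nlinarith
    _ = C * 2 ^ d * 2 ^ (d * k) * (s + 1) ^ d := by rw [mul_pow, mul_pow]; ring
    _ ≤ (C * 2 ^ d + d) * 2 ^ ((C * 2 ^ d + d) * k) * (s + 1) ^ (C * 2 ^ d + d) := by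
      gcongr <;> omega

theorem polyBounded_cost (p : Cmd) : PolyBounded fun B => p.cost B := by
  induction p with
  | skip | assign | store => exact .const _
  | seq p q ihp ihq => exact ihp.add ihq
  | ite e p q ihp ihq => exact (PolyBounded.const _).add ((ihp.add ihq).add (.const 1))
  | forLt _ _ p ih => exact (ih.add (.const 4)).id_mul.add (.const 3)

section Correctness

variable {K B : ℕ} {R : List ℕ}

/-- The compiled command simulates `p` as long as the loop bounds in `R` are at most `B`. -/
def Simulated (K B : ℕ) (R : List ℕ) (p : Cmd) : Prop :=
  ∀ ⦃σ τ : State⦄, Agree K σ τ → (∀ r ∈ R, σ.reg r ≤ B) →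
    ∃ t τ', Runs (p.compile K) τ t τ' ∧ t ≤ p.cost B ∧ Agree K (p.sem σ) τ'

theorem simulated_assign {x : ℕ} {e : Expr} (he : e.regsBelow K = true) :
    Simulated K B R (assign x e) := by
  intro σ τ h _
  obtain ⟨τ₁, r₁, h₁, v₁⟩ := e.runs_compile he le_rfl h
  refine ⟨_, _, .seq r₁ (.move _ _ _), le_rfl, ?_⟩
  rw [v₁]
  exact (h.trans h₁).setReg x _

theorem simulated_store {a : ℕ} {e₁ e₂ : Expr} (he₁ : e₁.regsBelow K = true)
    (he₂ : e₂.regsBelow K = true) : Simulated K B R (store a e₁ e₂) := by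
  intro σ τ h _
  obtain ⟨τ₁, r₁, h₁, v₁⟩ := e₁.runs_compile he₁ le_rfl h
  obtain ⟨τ₂, r₂, h₂, v₂⟩ := e₂.runs_compile he₂ K.le_succ (h.trans h₁)
  have h' := h.trans (h₁.trans (h₂.mono K.le_succ))
  refine ⟨_, _, .seq (.seq r₁ r₂) (.store _ _ _ _), le_rfl, h'.1, ?_⟩
  simp [State.setArr, sem, h₂.1 K K.lt_succ_self, v₁, v₂, h'.2]

theorem Simulated.seq {p q : Cmd} (hp : Simulated K B R p) (hq : Simulated K B R q)
    (hR : ∀ r ∈ R, p.writes r = false) : Simulated K B R (seq p q) := by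
  intro σ τ h hB
  obtain ⟨t₁, τ₁, r₁, l₁, h₁⟩ := hp h hB
  obtain ⟨t₂, τ₂, r₂, l₂, h₂⟩ := hq h₁ fun r hr =>
    ((p.frame_sem σ).1 r (hR r hr)).trans_le (hB r hr)
  exact ⟨_, _, .seq r₁ r₂, add_le_add l₁ l₂, h₂⟩

theorem Simulated.ite {e : Expr} {p q : Cmd} (he : e.regsBelow K = true)
    (hp : Simulated K B R p) (hq : Simulated K B R q) : Simulated K B R (ite e p q) := by
  intro σ τ h hB
  obtain ⟨τ₁, r₁, h₁, v₁⟩ := e.runs_compile he le_rfl h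
  by_cases h0 : e.Holds σ
  · obtain ⟨t, τ₂, r₂, l₂, h₂⟩ := hp (h.trans h₁) hB
    refine ⟨_, _, .seq r₁ (.cond_pos (v₁.trans_ne h0) r₂), ?_, by rwa [sem_ite_of_holds h0]⟩
    simp only [cost]
    omega
  · obtain ⟨t, τ₂, r₂, l₂, h₂⟩ := hq (h.trans h₁) hB
    refine ⟨_, _, .seq r₁ (.cond_zero (v₁.trans (not_not.1 h0)) r₂), ?_,
      by rwa [sem_ite_of_not_holds h0]⟩
    simp only [cost]
    omega

theorem Simulated.round {i b j : ℕ} {p : Cmd} (hp : Simulated K B R p) (hi : i < K) (hb : b < K)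
    (hib : b ≠ i) (hpi : p.writes i = false) (hpb : p.writes b = false) {σ τ : State}
    (hij : σ.reg i = j) (h : Agree K σ τ) (hB : ∀ r ∈ R, σ.reg r ≤ B) :
    ∃ t τ', Runs (compileRound K i b (p.compile K)) τ t τ' ∧ t ≤ p.cost B + 3 ∧
      Agree K ((p.sem σ).setReg i (j + 1)) τ' ∧ τ'.reg K = σ.reg b - (j + 1) := by
  obtain ⟨t, τ₁, r₁, l₁, h₁⟩ := hp h hB
  have counter : τ₁.reg i = j := by rw [h₁.1 i hi, (p.frame_sem σ).1 i hpi, hij]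
  have bound : τ₁.reg b = σ.reg b := by rw [h₁.1 b hb, (p.frame_sem σ).1 b hpb]
  refine ⟨_, _, .seq (.seq (.seq r₁ (.const K 1 _)) (.add i i K _)) (.sub K b i _), by omega,
    ?_, ?_⟩
  · have next : (τ₁.setReg K 1).reg i + (τ₁.setReg K 1).reg K = j + 1 := by
      simp [hi.ne, counter]
    rw [next]
    exact ((h₁.trans (agree_setReg le_rfl _ _)).setReg i _).trans (agree_setReg le_rfl _ _)
  · simp [hi.ne, hb.ne, hib, counter, bound]

theorem Simulated.loop {i b : ℕ} {p : Cmd} (hp : Simulated K B R p) (hi : i < K) (hb : b < K)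
    (hiR : i ∉ R) (hbR : b ∈ R) (hpi : p.writes i = false) (hR : ∀ r ∈ R, p.writes r = false)
    {σ : State} (hB : ∀ r ∈ R, σ.reg r ≤ B) (d : ℕ) :
    ∀ j, j + d = σ.reg b → ∀ τ, Agree K (loopState i p.sem σ j) τ → τ.reg K = d →
      ∃ t τ', Runs (.loop K (compileRound K i b (p.compile K))) τ t τ' ∧
        t ≤ d * (p.cost B + 4) + 1 ∧ Agree K ((Cmd.forLt i b p).sem σ) τ' := by
  have hR' : ∀ r ∈ R, (Cmd.forLt i b p).writes r = false := fun r hr => by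
    simp [writes, hR r hr, (ne_of_mem_of_not_mem hr hiR).symm]
  have kept : ∀ j, ∀ r ∈ R, (loopState i p.sem σ j).reg r = σ.reg r := fun j r hr =>
    (frame_loopState p.frame_sem i b σ j).1 r (hR' r hr)
  induction d with
  | zero =>
    rintro j hj τ h hd
    obtain rfl : j = σ.reg b := hj
    exact ⟨1, τ, .loop_done hd, by omega, h⟩
  | succ d ih =>
    intro j hj τ h hd
    obtain ⟨t₁, τ₁, r₁, l₁, h₁, hd₁⟩ := hp.round hi hb (ne_of_mem_of_not_mem hbR hiR) hpi (hR b hbR)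
      (reg_loopState_self i _ σ j) h fun r hr => (kept j r hr).trans_le (hB r hr)
    rw [kept j b hbR] at hd₁
    obtain ⟨t₂, τ₂, r₂, l₂, h₂⟩ := ih (j + 1) (by omega) τ₁ h₁ (by omega)
    refine ⟨_, _, .loop_step (by omega) r₁ r₂, ?_, h₂⟩
    linarith

theorem Simulated.forLt {i b : ℕ} {p : Cmd} (hp : Simulated K B R p) (hi : i < K) (hb : b < K)
    (hiR : i ∉ R) (hbR : b ∈ R) (hpi : p.writes i = false) (hR : ∀ r ∈ R, p.writes r = false) :
    Simulated K B R (.forLt i b p) := by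
  intro σ τ h hB
  have hib : b ≠ i := ne_of_mem_of_not_mem hbR hiR
  let τ₀ := (τ.setReg i 0).setReg K ((τ.setReg i 0).reg b - (τ.setReg i 0).reg i)
  have start : Agree K (σ.setReg i 0) τ₀ := (h.setReg i 0).trans (agree_setReg le_rfl _ _)
  have rounds : τ₀.reg K = σ.reg b := by simp [τ₀, hib, h.1 b hb]
  obtain ⟨t, τ₁, r₁, l₁, h₁⟩ :=
    hp.loop hi hb hiR hbR hpi hR hB (σ.reg b) 0 (zero_add _) τ₀ start rounds
  refine ⟨_, _, .seq (.seq (.const i 0 τ) (.sub K b i _)) r₁, ?_, h₁⟩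
  have : σ.reg b * (p.cost B + 4) ≤ B * (p.cost B + 4) := Nat.mul_le_mul_right _ (hB b hbR)
  simp only [cost]
  omega

theorem simulated_of_wf (p : Cmd) (hp : p.wf K R = true) : Simulated K B R p := by
  induction p with
  | skip => exact fun σ τ h _ => ⟨1, τ, .skip _, le_rfl, h⟩
  | assign x e =>
    simp only [wf, Bool.and_eq_true] at hp
    exact simulated_assign hp.2
  | store a e₁ e₂ =>
    simp only [wf, Bool.and_eq_true] at hp
    exact simulated_store hp.1 hp.2
  | seq p q ihp ihq =>
    simp only [wf, Bool.and_eq_true] at hp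
    exact (ihp hp.1).seq (ihq hp.2) fun r => wf.writes hp.1
  | ite e p q ihp ihq =>
    simp only [wf, Bool.and_eq_true] at hp
    exact .ite hp.1.1 (ihp hp.1.2) (ihq hp.2)
  | forLt i b p ih =>
    simp only [wf, Bool.and_eq_true, decide_eq_true_eq, Bool.not_eq_true'] at hp
    obtain ⟨⟨⟨⟨⟨hi, hiR⟩, hb⟩, hbR⟩, hpi⟩, hp⟩ := hp
    exact (ih hp).forLt hi hb hiR hbR hpi fun r => wf.writes hp

end Correctness

section Loops

variable {i b : ℕ} {p : Cmd} {σ : State}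

theorem forLt_induction (I : ℕ → State → Prop) (h0 : I 0 (σ.setReg i 0))
    (hs : ∀ j < σ.reg b, ∀ ρ : State, (Cmd.forLt i b p).Frame σ ρ → ρ.reg i = j → I j ρ →
      I (j + 1) ((p.sem ρ).setReg i (j + 1))) :
    I (σ.reg b) ((Cmd.forLt i b p).sem σ) := by
  suffices ∀ j ≤ σ.reg b, I j (loopState i p.sem σ j) from this _ le_rfl
  intro j
  induction j with
  | zero => exact fun _ => h0
  | succ j ih =>
    exact fun hj => hs j hj _ (frame_loopState p.frame_sem i b σ j) (reg_loopState_self _ _ _ _)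
      (ih (Nat.le_of_succ_le hj))

variable {A : Type*} {S : State → A → Prop}

theorem forLt_foldl {g : A → ℕ → A} (hS : ∀ ρ c x, S ρ x → S (ρ.setReg i c) x) {a : A}
    (h0 : S σ a)
    (hs : ∀ j < σ.reg b, ∀ ρ x, (Cmd.forLt i b p).Frame σ ρ → ρ.reg i = j → S ρ x →
      S (p.sem ρ) (g x j)) :
    S ((Cmd.forLt i b p).sem σ) ((List.range (σ.reg b)).foldl g a) := by
  refine forLt_induction (fun j ρ => S ρ ((List.range j).foldl g a)) (hS _ _ _ h0) ?_
  intro j hj ρ hF hij hρ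
  rw [List.range_succ, List.foldl_append]
  exact hS _ _ _ (hs j hj ρ _ hF hij hρ)

theorem forLt_iterate {g : A → A} (hS : ∀ ρ c x, S ρ x → S (ρ.setReg i c) x) {a : A}
    (h0 : S σ a) (hs : ∀ ρ x, S ρ x → S (p.sem ρ) (g x)) :
    S ((Cmd.forLt i b p).sem σ) (g^[σ.reg b] a) := by
  have := forLt_foldl (b := b) (g := fun x _ => g x) hS h0 fun _ _ ρ x _ _ => hs ρ x
  rwa [List.foldl_const, List.length_range] at this

theorem forLt_forLt_foldl {j c : ℕ} {g : A → ℕ × ℕ → A}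
    (hi : ∀ ρ v x, S ρ x → S (ρ.setReg i v) x) (hj : ∀ ρ v x, S ρ x → S (ρ.setReg j v) x)
    (hij : (Cmd.forLt j c p).writes i = false)
    (hc : (Cmd.forLt i b (.forLt j c p)).writes c = false) {a : A} (h0 : S σ a)
    (hs : ∀ q ∈ List.range (σ.reg b) ×ˢ List.range (σ.reg c), ∀ ρ x, ρ.reg i = q.1 →
      ρ.reg j = q.2 → S ρ x → S (p.sem ρ) (g x q)) :
    S ((Cmd.forLt i b (.forLt j c p)).sem σ)
      ((List.range (σ.reg b) ×ˢ List.range (σ.reg c)).foldl g a) := by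
  have flatten : (List.range (σ.reg b) ×ˢ List.range (σ.reg c)).foldl g a =
      (List.range (σ.reg b)).foldl
        (fun x e => (List.range (σ.reg c)).foldl (fun x f => g x (e, f)) x) a := by
    simp only [SProd.sprod, List.product, List.foldl_flatMap, List.foldl_map]
  rw [flatten]
  refine forLt_foldl hi h0 fun e he ρ x hρ hie hx => ?_
  rw [← hρ.1 c hc]
  refine forLt_foldl hj hx fun f hf τ y hτ hjf hy => ?_
  refine hs (e, f) (List.pair_mem_product.2 ⟨List.mem_range.2 he, List.mem_range.2 ?_⟩) τ y
    ((hτ.1 i hij).trans hie) hjf hy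
  rwa [← hρ.1 c hc]

end Loops

end Cmd

end ForLang

namespace NestSetSearch

open Finset RAM ForLang Expr Cmd

namespace Reg

abbrev outLen := 1
abbrev n := 2
abbrev m := 3
abbrev k := 4
abbrev pow := 5
abbrev choices := 6
abbrev changed := 7
abbrev root := 8
abbrev word := 9
abbrev sweep := 10
abbrev pass := 11
abbrev fst := 12
abbrev snd := 13
abbrev vertex := 14
abbrev test := 15
abbrev size := 16
abbrev offset := 17
abbrev scratch := 18

end Reg

namespace Arr

abbrev input := 0
abbrev output := 1
abbrev deleted := 2
abbrev candidate := 3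
abbrev offset := 4

end Arr

/-- The vertex in question is in the edge `Rx` and has not been deleted. -/
def live (x : ℕ) : Expr :=
  and (load Arr.input (add (load Arr.offset (var x)) (var Reg.vertex)))
    (not (load Arr.deleted (var Reg.vertex)))

/-- The vertex in question is in the candidate set. -/
def chosen : Expr := load Arr.candidate (var Reg.vertex)

/-- Computes in `R test` whether `c` holds for some vertex. -/
def anyVertex (c : Expr) : Cmd :=
  seq (assign Reg.test (const 0))
    (.forLt Reg.vertex Reg.n (ite c (assign Reg.test (const 1)) skip))

/-- Executes `p` if `c` holds for some vertex. -/
def whenAny (c : Expr) (p : Cmd) : Cmd :=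
  seq (anyVertex c) (ite (var Reg.test) p skip)

/-- Makes the array `a` the characteristic vector of the vertices that satisfy `c`. -/
def fill (a : ℕ) (c : Expr) : Cmd :=
  .forLt Reg.vertex Reg.n (store a (var Reg.vertex) c)

/-- Adds `E x \ E y` to the candidate set. -/
def extendCmd (x y : ℕ) : Cmd :=
  fill Arr.candidate (add chosen (and (live x) (not (live y))))

/-- Resolves an incomparable pair of edges by the next choice. -/
def resolveCmd : Cmd :=
  seq
    (ite (sub (var Reg.choices) (add (half (var Reg.choices)) (half (var Reg.choices))))
      (extendCmd Reg.fst Reg.snd) (extendCmd Reg.snd Reg.fst))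
    (seq (assign Reg.choices (half (var Reg.choices))) (assign Reg.changed (const 1)))

/-- The program for `step`. -/
def stepCmd : Cmd :=
  whenAny (and (live Reg.fst) chosen) <|
    whenAny (and (live Reg.snd) chosen) <|
      whenAny (and (live Reg.fst) (not (add (live Reg.snd) chosen))) <|
        whenAny (and (live Reg.snd) (not (add (live Reg.fst) chosen))) resolveCmd

/-- The program for `pass`. -/
def passCmd : Cmd :=
  seq (assign Reg.changed (const 0)) (.forLt Reg.fst Reg.m (.forLt Reg.snd Reg.m stepCmd))

/-- The program for `search`. -/
def searchCmd : Cmd :=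
  seq
    (seq (assign Reg.choices (var Reg.word)) (assign Reg.changed (const 1)))
    (seq
      (fill Arr.candidate (not (add (sub (var Reg.root) (var Reg.vertex))
        (sub (var Reg.vertex) (var Reg.root)))))
      (.forLt Reg.pass Reg.k passCmd))

/-- Computes the size of the candidate set. -/
def countCmd : Cmd :=
  seq (assign Reg.size (const 0))
    (.forLt Reg.vertex Reg.n (assign Reg.size (add (var Reg.size) (not (not chosen)))))

/-- Appends a number to the output. -/
def append (e : Expr) : Cmd :=
  seq (store Arr.output (var Reg.outLen) e)
    (assign Reg.outLen (add (var Reg.outLen) (const 1)))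

/-- Appends the elements of the candidate set to the output. -/
def listCmd : Cmd :=
  .forLt Reg.vertex Reg.n (ite chosen (append (add (var Reg.vertex) (const 1))) skip)

/-- Outputs and deletes the candidate set. -/
def emitCmd : Cmd :=
  seq (seq listCmd (append (const 0)))
    (fill Arr.deleted (add (load Arr.deleted (var Reg.vertex)) chosen))

/-- The program for `attempt`. -/
def attemptCmd : Cmd :=
  ite (load Arr.deleted (var Reg.root)) skip
    (seq (seq searchCmd countCmd)
      (ite (add (var Reg.changed) (sub (var Reg.size) (var Reg.k))) skip emitCmd))

/-- The program for `eliminate`. -/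
def eliminateCmd : Cmd :=
  .forLt Reg.sweep Reg.n (.forLt Reg.root Reg.n (.forLt Reg.word Reg.pow attemptCmd))

/-- Accepts by a change of the first entry of the output to `1`, or rejects by the removal of all
other entries. The hypergraph with no vertices and the edge `∅` must be rejected, although all its
vertices are deleted from the beginning. -/
def answerCmd : Cmd :=
  seq (anyVertex (not (load Arr.deleted (var Reg.vertex))))
    (ite (add (var Reg.test) (and (var Reg.m) (not (var Reg.n))))
      (assign Reg.outLen (const 1)) (store Arr.output (const 0) (const 1)))

/-- Reads the three numbers at the beginning of the input. -/
def readCmd : Cmd :=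
  seq (seq (assign Reg.k (load Arr.input (const 0))) (assign Reg.n (load Arr.input (const 1))))
    (assign Reg.m (load Arr.input (const 2)))

/-- Computes `2 ^ k`. -/
def powCmd : Cmd :=
  seq (assign Reg.pow (const 1))
    (.forLt Reg.pass Reg.k (assign Reg.pow (add (var Reg.pow) (var Reg.pow))))

/-- Computes where the characteristic vectors of the edges begin in the input. -/
def offsetCmd : Cmd :=
  seq (assign Reg.offset (add (var Reg.n) (const 3)))
    (.forLt Reg.fst Reg.m
      (seq (store Arr.offset (var Reg.fst) (var Reg.offset))
        (assign Reg.offset (add (var Reg.offset) (var Reg.n)))))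

/-- Everything between the reading of the three numbers and the elimination. -/
def setupCmd : Cmd := seq (seq powCmd offsetCmd) (append (const 0))

/-- The elimination and the answer. -/
def solveCmd : Cmd := seq eliminateCmd answerCmd

/-- The algorithm for the computation of a `k`-NEO. -/
def algorithm : Cmd := seq (seq readCmd setupCmd) solveCmd

section Generic

variable {σ : State} {c : Expr}

theorem anyVertex_spec {Q : ℕ → Prop}
    (hQ : ∀ ρ : State, (anyVertex c).Frame σ ρ → ρ.reg Reg.vertex < σ.reg Reg.n →
      (c.Holds ρ ↔ Q (ρ.reg Reg.vertex))) :
    ((anyVertex c).sem σ).reg Reg.test ≠ 0 ↔ ∃ v < σ.reg Reg.n, Q v := by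
  have start : (anyVertex c).Frame σ (σ.setReg Reg.test 0) :=
    (frame_assign Reg.test (const 0) σ 0).mono (by simp +contextual [anyVertex, writes])
      (by simp [writesArr])
  refine forLt_induction (σ := σ.setReg Reg.test 0)
    (fun j ρ => ρ.reg Reg.test ≠ 0 ↔ ∃ v < j, Q v) (by simp +decide) ?_
  intro j hj ρ hρ hij ih
  have hc : c.Holds ρ ↔ Q j := by
    rw [hQ ρ (start.trans (hρ.mono (by simp [anyVertex, writes]) (by simp [anyVertex, writesArr])))
      (hij.trans_lt hj), hij]
  have split : (∃ v < j + 1, Q v) ↔ (∃ v < j, Q v) ∨ Q j := by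
    simp only [Nat.lt_succ_iff_lt_or_eq, or_and_right, exists_or, exists_eq_left]
  rw [split]
  by_cases h : Q j
  · rw [sem_ite_of_holds (hc.2 h)]
    simp +decide [sem, eval, h]
  · rw [sem_ite_of_not_holds (hc.not.2 h)]
    simpa +decide [sem, h] using ih

theorem whenAny_spec {I J : State → Prop} {Q : ℕ → Prop} {n : ℕ} {p : Cmd}
    (hI : ∀ ρ τ, (anyVertex c).Frame ρ τ → I ρ → I τ)
    (hn : ∀ ρ, I ρ → ρ.reg Reg.n = n)
    (hQ : ∀ ρ, I ρ → ρ.reg Reg.vertex < n → (c.Holds ρ ↔ Q (ρ.reg Reg.vertex)))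
    (pos : (∃ v < n, Q v) → ∀ ρ, I ρ → J (p.sem ρ))
    (neg : (¬ ∃ v < n, Q v) → ∀ ρ, I ρ → J ρ) (hσ : I σ) : J ((whenAny c p).sem σ) := by
  have test : (var Reg.test).Holds ((anyVertex c).sem σ) ↔ ∃ v < n, Q v := by
    rw [holds_var, ← hn σ hσ]
    exact anyVertex_spec fun ρ hρ hv => hQ ρ (hI σ ρ hρ hσ) (hv.trans_eq (hn σ hσ))
  have kept : I ((anyVertex c).sem σ) := hI _ _ (frame_sem _ _) hσ
  rw [whenAny, sem]
  by_cases h : ∃ v < n, Q v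
  · rw [sem_ite_of_holds (test.2 h)]
    exact pos h _ kept
  · rw [sem_ite_of_not_holds (test.not.2 h)]
    exact neg h _ kept

/-- The set with the characteristic vector `A`, where every nonzero value stands for true. -/
def supp (n : ℕ) (A : ℕ → ℕ) : Finset ℕ := (range n).filter (A · ≠ 0)

theorem mem_supp {n : ℕ} {A : ℕ → ℕ} {v : ℕ} : v ∈ supp n A ↔ v < n ∧ A v ≠ 0 := by simp [supp]

theorem supp_subset (n : ℕ) (A : ℕ → ℕ) : supp n A ⊆ range n := filter_subset _ _

theorem fill_spec {a n : ℕ} {S : Finset ℕ} (hn : σ.reg Reg.n = n) (hS : S ⊆ range n)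
    (hc : ∀ ρ : State, (fill a c).Frame σ ρ → ρ.reg Reg.vertex < n →
      ρ.arr a (ρ.reg Reg.vertex) = σ.arr a (ρ.reg Reg.vertex) →
      (c.Holds ρ ↔ ρ.reg Reg.vertex ∈ S)) :
    supp n (((fill a c).sem σ).arr a) = S := by
  subst hn
  have filled : (∀ v < σ.reg Reg.n, ((fill a c).sem σ).arr a v ≠ 0 ↔ v ∈ S) ∧
      ∀ v ≥ σ.reg Reg.n, ((fill a c).sem σ).arr a v = σ.arr a v := by
    refine forLt_induction (fun j ρ => (∀ v < j, ρ.arr a v ≠ 0 ↔ v ∈ S) ∧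
      ∀ v ≥ j, ρ.arr a v = σ.arr a v) (by simp) ?_
    rintro j hj ρ hρ rfl ⟨ih, rest⟩
    have hcj : c.eval ρ ≠ 0 ↔ ρ.reg Reg.vertex ∈ S := hc ρ hρ hj (rest _ le_rfl)
    refine ⟨fun v hv => ?_, fun v hv => ?_⟩
    · rcases Nat.lt_succ_iff_lt_or_eq.1 hv with hv | rfl
      · simpa [sem, eval, hv.ne] using ih v hv
      · simpa [sem, eval] using hcj
    · simpa [sem, eval, (Nat.lt_of_succ_le hv).ne'] using rest v (Nat.le_of_succ_le hv)
  ext v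
  rw [mem_supp]
  exact ⟨fun h => (filled.1 v h.1).1 h.2, fun h =>
    ⟨mem_range.1 (hS h), (filled.1 v (mem_range.1 (hS h))).2 h⟩⟩

theorem output_append (e : Expr) (σ : State) :
    ((append e).sem σ).output = σ.output ++ [e.eval σ] := by
  have kept : (List.range (σ.reg 1)).map (((append e).sem σ).arr 1) = σ.output :=
    List.map_congr_left fun i hi => by simp [append, sem, eval, (List.mem_range.1 hi).ne]
  rw [← kept]
  simp [State.output, append, sem, eval, List.range_succ]

theorem output_of_frame {p : Cmd} {τ : State} (h : p.Frame σ τ)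
    (hp : (p.writes Reg.outLen || p.writesArr Arr.output) = false) : τ.output = σ.output := by
  rw [Bool.or_eq_false_iff] at hp
  rw [State.output, State.output, h.1 1 hp.1, h.2 1 hp.2]

end Generic

/-- The command leaves the registers and arrays alone in which the hypergraph is stored. -/
def keepsInput (p : Cmd) : Bool :=
  !(p.writes Reg.n || p.writes Reg.m || p.writes Reg.k || p.writes Reg.pow ||
    p.writesArr Arr.input || p.writesArr Arr.offset)

/-- The command also leaves the array of the deleted vertices alone. -/
def keepsRemaining (p : Cmd) : Bool := keepsInput p && !p.writesArr Arr.deleted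

/-- The command also leaves the state of the search alone. -/
def keepsSearch (p : Cmd) : Bool :=
  keepsRemaining p &&
    !(p.writesArr Arr.candidate || p.writes Reg.choices || p.writes Reg.changed)

/-- The state stores the hypergraph with the vertices `0, …, n - 1` and the edges
`E 0, …, E (m - 1)`, the parameter `k`, and a set `D` of deleted vertices. -/
structure Stores (E : ℕ → Finset ℕ) (D : Finset ℕ) (n m k : ℕ) (σ : State) : Prop where
  subset : ∀ e, E e ⊆ range n
  reg_n : σ.reg Reg.n = n
  reg_m : σ.reg Reg.m = m
  reg_k : σ.reg Reg.k = k
  reg_pow : σ.reg Reg.pow = 2 ^ k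
  edge : ∀ e < m, ∀ v < n, σ.arr Arr.input (σ.arr Arr.offset e + v) ≠ 0 ↔ v ∈ E e
  deleted : supp n (σ.arr Arr.deleted) = D

/-- In addition, the state stores the configuration `c` of the search for a nest-set. -/
structure StoresSearch (E : ℕ → Finset ℕ) (D : Finset ℕ) (n m k : ℕ) (σ : State) (c : Config ℕ) :
    Prop extends Stores E D n m k σ where
  set : supp n (σ.arr Arr.candidate) = c.set
  choices : σ.reg Reg.choices = c.choices
  changed : σ.reg Reg.changed ≠ 0 ↔ c.changed = true

section Search

variable {E : ℕ → Finset ℕ} {D : Finset ℕ} {n m k : ℕ} {σ τ : State} {c : Config ℕ} {p : Cmd}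

theorem Stores.delete (h : Stores E D n m k σ) (hF : p.Frame σ τ) (hp : keepsInput p = true)
    {D' : Finset ℕ} (hD : supp n (τ.arr Arr.deleted) = D') : Stores E D' n m k τ := by
  simp only [keepsInput, Bool.not_eq_true', Bool.or_eq_false_iff] at hp
  obtain ⟨⟨⟨⟨⟨hn, hm⟩, hk⟩, hpow⟩, hinput⟩, hoffset⟩ := hp
  exact ⟨h.subset, (hF.1 _ hn).trans h.reg_n, (hF.1 _ hm).trans h.reg_m,
    (hF.1 _ hk).trans h.reg_k, (hF.1 _ hpow).trans h.reg_pow,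
    by rw [hF.2 _ hinput, hF.2 _ hoffset]; exact h.edge, hD⟩

theorem Stores.frame (h : Stores E D n m k σ) (hF : p.Frame σ τ) (hp : keepsRemaining p = true) :
    Stores E D n m k τ := by
  rw [keepsRemaining, Bool.and_eq_true, Bool.not_eq_true'] at hp
  exact h.delete hF hp.1 (by rw [hF.2 _ hp.2, h.deleted])

theorem StoresSearch.frame (h : StoresSearch E D n m k σ c) (hF : p.Frame σ τ)
    (hp : keepsSearch p = true) : StoresSearch E D n m k τ c := by
  simp only [keepsSearch, Bool.and_eq_true, Bool.not_eq_true', Bool.or_eq_false_iff] at hp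
  obtain ⟨hp, ⟨hset, hchoices⟩, hchanged⟩ := hp
  exact ⟨h.toStores.frame hF hp, by rw [hF.2 _ hset, h.set], by rw [hF.1 _ hchoices, h.choices],
    by rw [hF.1 _ hchanged, h.changed]⟩

theorem Stores.holds_live (h : Stores E D n m k σ) {x : ℕ} (hx : σ.reg x < m)
    (hv : σ.reg Reg.vertex < n) :
    (live x).Holds σ ↔ σ.reg Reg.vertex ∈ remove E D (σ.reg x) := by
  rw [remove, mem_sdiff, ← h.edge _ hx _ hv, ← h.deleted, mem_supp, live, holds_and, holds_not]
  simp [Holds, eval, hv]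

theorem StoresSearch.holds_chosen (h : StoresSearch E D n m k σ c) (hv : σ.reg Reg.vertex < n) :
    chosen.Holds σ ↔ σ.reg Reg.vertex ∈ c.set := by
  simp [← h.set, mem_supp, hv, chosen, Holds, eval]

theorem extendCmd_spec (h : StoresSearch E D n m k σ c) {x y : ℕ} (hx : σ.reg x < m)
    (hy : σ.reg y < m) (hxv : x ≠ Reg.vertex) (hyv : y ≠ Reg.vertex) :
    StoresSearch E D n m k ((extendCmd x y).sem σ)
      { c with set := c.set ∪ remove E D (σ.reg x) \ remove E D (σ.reg y) } := by
  have stores : ∀ ρ, (extendCmd x y).Frame σ ρ → Stores E D n m k ρ := fun ρ hρ =>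
    h.toStores.frame hρ rfl
  refine ⟨stores _ (frame_sem _ _), fill_spec h.reg_n ?_ ?_,
    ((frame_sem (extendCmd x y) σ).1 _ rfl).trans h.choices,
    by rw [(frame_sem (extendCmd x y) σ).1 _ rfl, h.changed]⟩
  · exact union_subset (h.set ▸ supp_subset n _)
      (sdiff_subset.trans (sdiff_subset.trans (h.subset _)))
  · intro ρ hρ hv hcell
    have keep : ∀ z, z ≠ Reg.vertex → ρ.reg z = σ.reg z := fun z hz =>
      hρ.1 z (by simp [fill, writes, hz.symm])
    have cell : chosen.Holds ρ ↔ ρ.reg Reg.vertex ∈ c.set := by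
      rw [← h.set, mem_supp, ← hcell]
      exact (and_iff_right hv).symm
    rw [holds_add, cell, holds_and, holds_not,
      (stores ρ hρ).holds_live (by rwa [keep x hxv]) hv,
      (stores ρ hρ).holds_live (by rwa [keep y hyv]) hv, keep x hxv, keep y hyv, mem_union,
      mem_sdiff]

/-- In addition, the state stores the pair `q` of edges. -/
structure StoresPair (E : ℕ → Finset ℕ) (D : Finset ℕ) (n m k : ℕ) (c : Config ℕ) (q : ℕ × ℕ)
    (σ : State) : Prop extends StoresSearch E D n m k σ c where
  fst : σ.reg Reg.fst = q.1
  snd : σ.reg Reg.snd = q.2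
  fst_lt : q.1 < m
  snd_lt : q.2 < m

variable {q : ℕ × ℕ}

theorem StoresPair.holds_fst (h : StoresPair E D n m k c q σ) (hv : σ.reg Reg.vertex < n) :
    (live Reg.fst).Holds σ ↔ σ.reg Reg.vertex ∈ remove E D q.1 := by
  rw [h.holds_live (h.fst.trans_lt h.fst_lt) hv, h.fst]

theorem StoresPair.holds_snd (h : StoresPair E D n m k c q σ) (hv : σ.reg Reg.vertex < n) :
    (live Reg.snd).Holds σ ↔ σ.reg Reg.vertex ∈ remove E D q.2 := by
  rw [h.holds_live (h.snd.trans_lt h.snd_lt) hv, h.snd]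

theorem resolveCmd_spec (h : StoresPair E D n m k c q σ)
    (hc : Incomparable (remove E D) c.set q.1 q.2) :
    StoresSearch E D n m k (resolveCmd.sem σ) (step (remove E D) c q) := by
  have update : ∀ {ρ S}, StoresSearch E D n m k ρ { c with set := S } →
      StoresSearch E D n m k ((seq (assign Reg.choices (half (var Reg.choices)))
        (assign Reg.changed (const 1))).sem ρ) ⟨S, c.choices / 2, true⟩ := fun hρ =>
    ⟨hρ.toStores.frame (frame_sem _ _) rfl, hρ.set, by simp +decide [sem, eval, hρ.choices],
      by simp +decide [sem, eval]⟩
  have odd : (sub (var Reg.choices) (add (half (var Reg.choices)) (half (var Reg.choices)))).Holds σ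
      ↔ ¬ c.choices % 2 = 0 := by
    rw [← h.choices]
    simp only [Holds, eval]
    omega
  have fst_lt := h.fst.trans_lt h.fst_lt
  have snd_lt := h.snd.trans_lt h.snd_lt
  rw [step, if_pos hc, resolveCmd, sem, ← h.fst, ← h.snd]
  by_cases hb : c.choices % 2 = 0
  · rw [sem_ite_of_not_holds (odd.not.2 (not_not.2 hb)), if_pos hb]
    exact update (extendCmd_spec h.toStoresSearch snd_lt fst_lt (by decide) (by decide))
  · rw [sem_ite_of_holds (odd.2 hb), if_neg hb]
    exact update (extendCmd_spec h.toStoresSearch fst_lt snd_lt (by decide) (by decide))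

theorem StoresPair.whenAny_spec (h : StoresPair E D n m k c q σ) (b : Expr) (S : Finset ℕ)
    (hS : S ⊆ range n)
    (hb : ∀ ρ, StoresPair E D n m k c q ρ → ρ.reg Reg.vertex < n →
      (b.Holds ρ ↔ ρ.reg Reg.vertex ∈ S))
    (inc : Incomparable (remove E D) c.set q.1 q.2 → S.Nonempty)
    (pos : S.Nonempty → ∀ ρ, StoresPair E D n m k c q ρ →
      StoresSearch E D n m k (p.sem ρ) (step (remove E D) c q)) :
    StoresSearch E D n m k ((whenAny b p).sem σ) (step (remove E D) c q) := by
  have exists_iff : (∃ v < n, v ∈ S) ↔ S.Nonempty :=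
    exists_congr fun v => and_iff_right_of_imp fun hv => mem_range.1 (hS hv)
  refine NestSetSearch.whenAny_spec (I := StoresPair E D n m k c q)
    (J := fun ρ => StoresSearch E D n m k ρ (step (remove E D) c q)) (Q := (· ∈ S)) ?_
    (fun _ hρ => hρ.reg_n) hb (fun hne => pos (exists_iff.1 hne)) (fun hne ρ hρ => ?_) h
  · exact fun ρ τ hF hρ => ⟨hρ.toStoresSearch.frame hF rfl, (hF.1 _ rfl).trans hρ.fst,
      (hF.1 _ rfl).trans hρ.snd, hρ.fst_lt, hρ.snd_lt⟩
  · rw [step, if_neg fun hc => hne (exists_iff.2 (inc hc))]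
    exact hρ.toStoresSearch

theorem stepCmd_spec (h : StoresPair E D n m k c q σ) :
    StoresSearch E D n m k (stepCmd.sem σ) (step (remove E D) c q) := by
  have inRange : ∀ {e S}, S ⊆ remove E D e → S ⊆ range n := fun hS =>
    (hS.trans sdiff_subset).trans (h.subset _)
  have differ : ∀ e f, (remove E D e \ (remove E D f ∪ c.set)).Nonempty ↔
      ¬ remove E D e \ remove E D f ⊆ c.set := fun e f => by
    rw [sdiff_nonempty, sdiff_le_iff, sup_eq_union]
  refine h.whenAny_spec (and (live Reg.fst) chosen) _ (inRange inter_subset_left)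
    (fun ρ hρ hv => by rw [holds_and, hρ.holds_fst hv, hρ.holds_chosen hv, mem_inter])
    (fun hc => hc.1) fun h₁ σ₁ hσ₁ => ?_
  refine hσ₁.whenAny_spec (and (live Reg.snd) chosen) _ (inRange inter_subset_left)
    (fun ρ hρ hv => by rw [holds_and, hρ.holds_snd hv, hρ.holds_chosen hv, mem_inter])
    (fun hc => hc.2.1) fun h₂ σ₂ hσ₂ => ?_
  refine hσ₂.whenAny_spec (and (live Reg.fst) (not (add (live Reg.snd) chosen))) _
    (inRange sdiff_subset)
    (fun ρ hρ hv => by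
      rw [holds_and, holds_not, holds_add, hρ.holds_fst hv, hρ.holds_snd hv, hρ.holds_chosen hv,
        ← mem_union, mem_sdiff])
    (fun hc => (differ _ _).2 hc.2.2.1) fun h₃ σ₃ hσ₃ => ?_
  refine hσ₃.whenAny_spec (and (live Reg.snd) (not (add (live Reg.fst) chosen))) _
    (inRange sdiff_subset)
    (fun ρ hρ hv => by
      rw [holds_and, holds_not, holds_add, hρ.holds_fst hv, hρ.holds_snd hv, hρ.holds_chosen hv,
        ← mem_union, mem_sdiff])
    (fun hc => (differ _ _).2 hc.2.2.2) fun h₄ ρ hρ => ?_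
  exact resolveCmd_spec hρ ⟨h₁, h₂, (differ _ _).1 h₃, (differ _ _).1 h₄⟩

theorem passCmd_spec (h : StoresSearch E D n m k σ c) :
    StoresSearch E D n m k (passCmd.sem σ) (pass (remove E D) m c) := by
  have start : StoresSearch E D n m k (σ.setReg Reg.changed 0) { c with changed := false } :=
    ⟨h.toStores.frame (frame_assign _ (const 0) _ _) rfl, h.set, h.choices, by simp⟩
  have counter : ∀ i, keepsSearch (assign i (const 0)) = true → ∀ ρ v c',
      StoresSearch E D n m k ρ c' → StoresSearch E D n m k (ρ.setReg i v) c' :=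
    fun i hi ρ v c' hρ => hρ.frame (frame_assign i (const 0) ρ v) hi
  have := forLt_forLt_foldl (p := stepCmd) (b := Reg.m) (c := Reg.m)
    (g := step (remove E D)) (counter Reg.fst rfl) (counter Reg.snd rfl) rfl rfl start
    fun q hq ρ c' hi hj hρ => ?_
  · rwa [start.reg_m] at this
  · obtain ⟨h1, h2⟩ := List.pair_mem_product.1 hq
    rw [start.reg_m, List.mem_range] at h1 h2
    exact stepCmd_spec ⟨hρ, hi, hj, h1, h2⟩

theorem searchCmd_spec (h : Stores E D n m k σ) (hv : σ.reg Reg.root < n) :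
    StoresSearch E D n m k (searchCmd.sem σ)
      (search (remove E D) m k (σ.reg Reg.root) (σ.reg Reg.word)) := by
  set ρ := (seq (assign Reg.choices (var Reg.word)) (assign Reg.changed (const 1))).sem σ with hρ
  have stores : Stores E D n m k ρ := h.frame (frame_sem _ _) rfl
  have root : ρ.reg Reg.root = σ.reg Reg.root := (frame_sem _ _).1 _ rfl
  let init := fill Arr.candidate (not (add (sub (var Reg.root) (var Reg.vertex))
    (sub (var Reg.vertex) (var Reg.root))))
  have start : StoresSearch E D n m k (init.sem ρ) ⟨{σ.reg Reg.root}, σ.reg Reg.word, true⟩ := by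
    refine ⟨stores.frame (frame_sem _ _) rfl, fill_spec stores.reg_n (by simpa using hv) ?_,
      (frame_sem _ _).1 _ rfl, ?_⟩
    · intro τ hτ _ _
      rw [mem_singleton, ← root, ← hτ.1 Reg.root rfl]
      simp only [Holds, Expr.not, eval]
      omega
    · rw [(frame_sem init ρ).1 Reg.changed rfl]
      simp [hρ, sem, eval]
  have := forLt_iterate (b := Reg.k)
    (fun τ v c' hτ => hτ.frame (frame_assign Reg.pass (const 0) τ v) rfl) start
    fun τ c' hτ => passCmd_spec hτ
  rwa [start.reg_k] at this

theorem countCmd_spec (h : StoresSearch E D n m k σ c) :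
    (countCmd.sem σ).reg Reg.size = c.set.card := by
  rw [← h.set, supp, card_filter, ← h.reg_n]
  refine forLt_induction (σ := σ.setReg Reg.size 0)
    (fun j ρ => ρ.reg Reg.size = ∑ v ∈ range j, if σ.arr Arr.candidate v ≠ 0 then 1 else 0)
    (by simp +decide) ?_
  intro j _ ρ hρ hij ih
  have cell : (not (not chosen)).eval ρ = if σ.arr Arr.candidate j ≠ 0 then 1 else 0 := by
    simp only [Expr.not, chosen, eval, hij, hρ.2 Arr.candidate rfl, State.arr_setReg]
    split_ifs <;> omega
  rw [sum_range_succ, ← ih, ← cell]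
  simp +decide [sem, eval]

end Search

section Eliminate

/-- The description of the set `S` of vertices in the output word. -/
def codeSet (n : ℕ) (S : Finset ℕ) : List ℕ := ((List.range n).filter (· ∈ S)).map (· + 1) ++ [0]

/-- The description of the elimination `O`, the last set of `O` first. -/
def code (n : ℕ) (O : List (Finset ℕ)) : List ℕ := (O.reverse.map (codeSet n)).flatten

/-- The state of the program after the elimination of the sets in `O`. The leading `0` of the output
stands for rejection. -/
structure StoresElimination (E : ℕ → Finset ℕ) (n m k : ℕ) (σ : State) (O : List (Finset ℕ)) :
    Prop extends Stores E (NestSetSearch.deleted O) n m k σ where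
  output : σ.output = 0 :: code n O

variable {E : ℕ → Finset ℕ} {n m k : ℕ} {σ τ : State} {O : List (Finset ℕ)} {p : Cmd}

theorem StoresElimination.frame (h : StoresElimination E n m k σ O) (hF : p.Frame σ τ)
    (hp : keepsRemaining p = true)
    (hout : (p.writes Reg.outLen || p.writesArr Arr.output) = false) :
    StoresElimination E n m k τ O :=
  ⟨h.toStores.frame hF hp, (output_of_frame hF hout).trans h.output⟩

theorem listCmd_spec (hn : σ.reg Reg.n = n) {S : Finset ℕ} (hS : supp n (σ.arr Arr.candidate) = S) :
    (listCmd.sem σ).output = σ.output ++ ((List.range n).filter (· ∈ S)).map (· + 1) := by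
  subst hn
  refine forLt_induction (fun j ρ => ρ.output =
    σ.output ++ ((List.range j).filter (· ∈ S)).map (· + 1))
    (by simp [output_of_frame (frame_assign Reg.vertex (const 0) σ 0) rfl]) ?_
  intro j hj ρ hρ hij ih
  have cell : chosen.Holds ρ ↔ j ∈ S := by
    simp only [← hS, mem_supp, hj, true_and, Holds, chosen, eval, hij, hρ.2 Arr.candidate rfl]
  rw [output_of_frame (frame_assign Reg.vertex (const 0) _ _) rfl, List.range_succ,
    List.filter_append, List.map_append, ← List.append_assoc, ← ih]
  by_cases h : j ∈ S
  · rw [sem_ite_of_holds (cell.2 h), output_append]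
    simp [eval, hij, h]
  · rw [sem_ite_of_not_holds (cell.not.2 h)]
    simp [sem, h]

theorem emitCmd_spec (h : StoresElimination E n m k σ O) {S : Finset ℕ}
    (hS : supp n (σ.arr Arr.candidate) = S) :
    StoresElimination E n m k (emitCmd.sem σ) (S :: O) := by
  set ρ := (seq listCmd (append (const 0))).sem σ with hρ
  have hF : (seq listCmd (append (const 0))).Frame σ ρ := frame_sem _ _
  have stores : Stores E (NestSetSearch.deleted O) n m k ρ := h.toStores.frame hF rfl
  have outside : supp n (((fill Arr.deleted (add (load Arr.deleted (var Reg.vertex)) chosen)).sem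
      ρ).arr Arr.deleted) = S ∪ NestSetSearch.deleted O := by
    refine fill_spec stores.reg_n
      (union_subset (hS ▸ supp_subset n _) (h.deleted ▸ supp_subset n _)) fun τ hτ hv hcell => ?_
    have arr : τ.arr Arr.candidate = σ.arr Arr.candidate := (hτ.2 _ rfl).trans (hF.2 _ rfl)
    rw [holds_add, mem_union, ← stores.deleted, ← hS, mem_supp, mem_supp, ← hcell, ← arr, or_comm]
    exact or_congr (and_iff_right hv).symm (and_iff_right hv).symm
  refine ⟨stores.delete (frame_sem _ _) rfl outside, ?_⟩
  calc (emitCmd.sem σ).output = ρ.output := output_of_frame (frame_sem _ ρ) rfl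
    _ = σ.output ++ codeSet n S := by
      rw [hρ, sem, output_append, listCmd_spec h.reg_n hS, codeSet, List.append_assoc]
      rfl
    _ = 0 :: code n (S :: O) := by simp [h.output, code]

theorem attemptCmd_spec (h : StoresElimination E n m k σ O) (hv : σ.reg Reg.root < n) :
    StoresElimination E n m k (attemptCmd.sem σ)
      (attempt E m k O (σ.reg Reg.root, σ.reg Reg.word)) := by
  have root : (load Arr.deleted (var Reg.root)).Holds σ ↔
      σ.reg Reg.root ∈ NestSetSearch.deleted O := by
    rw [← h.deleted, mem_supp]
    exact (and_iff_right hv).symm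
  rw [attempt, attemptCmd]
  by_cases hdel : σ.reg Reg.root ∈ NestSetSearch.deleted O
  · rw [sem_ite_of_holds (root.2 hdel), if_neg fun hs => hs.1 hdel]
    exact h
  rw [sem_ite_of_not_holds (root.not.2 hdel), sem]
  set c := candidate E m k O (σ.reg Reg.root, σ.reg Reg.word) with hc
  have search := searchCmd_spec h.toStores hv
  set ρ := (seq searchCmd countCmd).sem σ
  have size : ρ.reg Reg.size = c.set.card := countCmd_spec search
  have counted : StoresSearch E (NestSetSearch.deleted O) n m k ρ c :=
    search.frame (frame_sem countCmd _) rfl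
  have failed : (add (var Reg.changed) (sub (var Reg.size) (var Reg.k))).Holds ρ ↔
      ¬ Succeeds E m k O (σ.reg Reg.root, σ.reg Reg.word) := by
    rw [Succeeds, ← hc, holds_add, holds_var, counted.changed, ← size, ← counted.reg_k]
    simp [Holds, eval, hdel, imp_iff_not_or, Nat.sub_eq_zero_iff_le]
  have kept : StoresElimination E n m k ρ O := h.frame (frame_sem _ _) rfl rfl
  split_ifs with hs
  · rw [sem_ite_of_not_holds (failed.not.2 (not_not.2 hs))]
    exact emitCmd_spec kept counted.set
  · rw [sem_ite_of_holds (failed.2 hs)]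
    exact kept

theorem eliminateCmd_spec (h : StoresElimination E n m k σ []) :
    StoresElimination E n m k (eliminateCmd.sem σ) (eliminate E m k (List.range n)) := by
  have counter : ∀ i, (keepsRemaining (assign i (const 0)) &&
      !((assign i (const 0)).writes Reg.outLen || (assign i (const 0)).writesArr Arr.output)) =
        true → ∀ ρ v O, StoresElimination E n m k ρ O → StoresElimination E n m k (ρ.setReg i v) O
    | i, hi, ρ, v, O, hρ => by
      rw [Bool.and_eq_true, Bool.not_eq_true'] at hi
      exact hρ.frame (frame_assign i (const 0) ρ v) hi.1 hi.2
  have := forLt_iterate (b := Reg.n)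
    (p := .forLt Reg.root Reg.n (.forLt Reg.word Reg.pow attemptCmd))
    (g := sweep E m k (List.range n)) (counter Reg.sweep rfl) h fun ρ O hρ => ?_
  · rw [eliminate, List.length_range]
    rwa [h.reg_n] at this
  have := forLt_forLt_foldl (p := attemptCmd) (b := Reg.n) (c := Reg.pow) (g := attempt E m k)
    (counter Reg.root rfl) (counter Reg.word rfl) rfl rfl hρ fun q hq τ O' hi hj hτ => ?_
  · rwa [hρ.reg_n, hρ.reg_pow] at this
  · have root_lt := List.mem_range.1 (List.pair_mem_product.1 hq).1
    have := attemptCmd_spec hτ (by rwa [hi, ← hρ.reg_n])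
    rwa [hi, hj] at this

theorem output_setArr (σ : State) (i c : ℕ) :
    (σ.setArr Arr.output i c).output = σ.output.set i c := by
  refine List.ext_getElem (by simp [State.output]) fun j _ _ => ?_
  simp [State.output, List.getElem_set, eq_comm]

theorem output_setReg {j : ℕ} (hj : j ≤ σ.reg Reg.outLen) :
    (σ.setReg Reg.outLen j).output = σ.output.take j := by
  rw [State.output, State.output, ← List.map_take, List.take_range, min_eq_left hj]
  simp

theorem Stores.anyVertex_not_deleted {D : Finset ℕ} (h : Stores E D n m k σ) :
    ((anyVertex (not (load Arr.deleted (var Reg.vertex)))).sem σ).reg Reg.test ≠ 0 ↔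
      D ≠ range n := by
  have hsub : D ⊆ range n := h.deleted ▸ supp_subset n _
  rw [anyVertex_spec (Q := (· ∉ D)), h.reg_n, ← not_iff_not, not_not]
  · push Not
    exact ⟨fun hall => hsub.antisymm fun v hv => hall v (mem_range.1 hv),
      fun heq v hv => heq ▸ mem_range.2 hv⟩
  · intro ρ hρ hv
    rw [h.reg_n] at hv
    rw [holds_not, ← h.deleted, mem_supp, Holds, eval, hρ.2 Arr.deleted rfl, eval]
    exact not_congr (and_iff_right hv).symm

theorem answerCmd_spec (h : StoresElimination E n m k σ O) :
    (answerCmd.sem σ).output =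
      if NestSetSearch.deleted O = range n ∧ (m ≠ 0 → n ≠ 0) then 1 :: code n O else [0] := by
  have remaining := h.anyVertex_not_deleted
  set b := not (load Arr.deleted (var Reg.vertex))
  set ρ := (anyVertex b).sem σ
  have kept : StoresElimination E n m k ρ O := h.frame (frame_sem _ _) rfl rfl
  have rejects : (add (var Reg.test) (and (var Reg.m) (not (var Reg.n)))).Holds ρ ↔
      ¬ (NestSetSearch.deleted O = range n ∧ (m ≠ 0 → n ≠ 0)) := by
    rw [holds_add, holds_var, remaining, holds_and, holds_not, holds_var, holds_var, kept.reg_m,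
      kept.reg_n]
    tauto
  rw [answerCmd, sem]
  split_ifs with haccept
  · rw [sem_ite_of_not_holds (rejects.not.2 (not_not.2 haccept)), sem, eval, eval, output_setArr,
      kept.output]
    rfl
  · have nonempty : 1 ≤ ρ.reg Reg.outLen := by
      have length := congrArg List.length kept.output
      rw [State.output, List.length_map, List.length_range] at length
      exact length ▸ Nat.succ_pos _
    rw [sem_ite_of_holds (rejects.2 haccept), sem, eval, output_setReg nonempty, kept.output]
    rfl

/-- The input word `w` describes the hypergraph with the vertices `0, …, n - 1` and the edges
`E 0, …, E (m - 1)`, and the parameter `k`. -/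
structure Encodes (E : ℕ → Finset ℕ) (n m k : ℕ) (w : List ℕ) : Prop where
  subset : ∀ e, E e ⊆ range n
  param : w.getD 0 0 = k
  card_vertices : w.getD 1 0 = n
  card_edges : w.getD 2 0 = m
  edge : ∀ e < m, ∀ v < n, w.getD (n + 3 + e * n + v) 0 ≠ 0 ↔ v ∈ E e

theorem powCmd_spec (σ : State) : (powCmd.sem σ).reg Reg.pow = 2 ^ σ.reg Reg.k := by
  refine forLt_induction (σ := σ.setReg Reg.pow 1) (fun j ρ => ρ.reg Reg.pow = 2 ^ j)
    (by simp +decide) fun j _ ρ _ _ ih => ?_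
  simp +decide [sem, eval, ih, pow_succ, mul_two]

theorem offsetCmd_spec (σ : State) : ∀ e < σ.reg Reg.m,
    (offsetCmd.sem σ).arr Arr.offset e = σ.reg Reg.n + 3 + e * σ.reg Reg.n := by
  refine (forLt_induction (σ := σ.setReg Reg.offset (σ.reg Reg.n + 3)) (b := Reg.m)
    (fun j ρ => ρ.reg Reg.offset = σ.reg Reg.n + 3 + j * σ.reg Reg.n ∧
      ∀ e < j, ρ.arr Arr.offset e = σ.reg Reg.n + 3 + e * σ.reg Reg.n) (by simp +decide) ?_).2
  rintro j _ ρ hρ hij ⟨next, ih⟩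
  refine ⟨?_, fun e he => ?_⟩
  · have step : ρ.reg Reg.n = σ.reg Reg.n := hρ.1 Reg.n rfl
    simp +decide [sem, eval, next, step]
    ring
  · rcases Nat.lt_succ_iff_lt_or_eq.1 he with he | rfl
    · simpa [sem, eval, hij, he.ne] using ih e he
    · simp [sem, eval, hij, next]

variable {w : List ℕ}

theorem setupCmd_spec (h : Encodes E n m k w) :
    StoresElimination E n m k (setupCmd.sem (readCmd.sem (State.init w))) [] := by
  set ρ := readCmd.sem (State.init w)
  have hF : setupCmd.Frame ρ (setupCmd.sem ρ) := frame_sem _ _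
  have reg_n : ρ.reg Reg.n = n := h.card_vertices
  have reg_m : ρ.reg Reg.m = m := h.card_edges
  have reg_k : ρ.reg Reg.k = k := h.param
  have pow : (setupCmd.sem ρ).reg Reg.pow = 2 ^ k := by
    rw [← reg_k, ← powCmd_spec ρ]
    exact (frame_sem (seq offsetCmd (append (const 0))) (powCmd.sem ρ)).1 Reg.pow rfl
  have offset : ∀ e < m, (setupCmd.sem ρ).arr Arr.offset e = n + 3 + e * n := by
    have := offsetCmd_spec (powCmd.sem ρ)
    rwa [(frame_sem powCmd ρ).1 Reg.m rfl, (frame_sem powCmd ρ).1 Reg.n rfl, reg_m, reg_n] at this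
  have input : (setupCmd.sem ρ).arr Arr.input = fun i => w.getD i 0 := hF.2 _ rfl
  have deleted : (setupCmd.sem ρ).arr Arr.deleted = fun _ => 0 := hF.2 _ rfl
  refine ⟨⟨h.subset, (hF.1 _ rfl).trans reg_n, (hF.1 _ rfl).trans reg_m, (hF.1 _ rfl).trans reg_k,
    pow, fun e he v hv => ?_, ?_⟩, ?_⟩
  · rw [input, offset e he]
    exact h.edge e he v hv
  · simp [deleted, supp, NestSetSearch.deleted]
  · have := output_append (const 0) ((seq powCmd offsetCmd).sem ρ)
    rwa [output_of_frame (frame_sem (seq powCmd offsetCmd) ρ) rfl,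
      output_of_frame (frame_sem readCmd (State.init w)) rfl] at this

theorem Stores.bounded {D : Finset ℕ} (h : Stores E D n m k σ) :
    ∀ r ∈ [Reg.n, Reg.m, Reg.k, Reg.pow], σ.reg r ≤ 2 ^ k + n + m := by
  have : k < 2 ^ k := Nat.lt_two_pow_self
  simp only [List.forall_mem_cons, h.reg_n, h.reg_m, h.reg_k, h.reg_pow]
  exact ⟨by omega, by omega, by omega, by omega, by simp⟩

theorem exists_computes (h : Encodes E n m k w) :
    ∃ t, (algorithm.compile Reg.scratch).Computes w t
        (if NestSetSearch.deleted (eliminate E m k (List.range n)) = range n ∧ (m ≠ 0 → n ≠ 0)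
          then 1 :: code n (eliminate E m k (List.range n)) else [0]) ∧
      t ≤ algorithm.cost (2 ^ k + n + m) := by
  have stores := setupCmd_spec h
  have input_bounded : ∀ r ∈ [Reg.n, Reg.m, Reg.k],
      (readCmd.sem (State.init w)).reg r ≤ 2 ^ k + n + m := fun r hr => by
    have kept : setupCmd.writes r = false := by fin_cases hr <;> rfl
    rw [← (frame_sem setupCmd _).1 r kept]
    exact stores.bounded r (List.mem_append_left [Reg.pow] hr)
  obtain ⟨t₁, τ₁, r₁, l₁, h₁⟩ := simulated_of_wf (K := Reg.scratch) (B := 2 ^ k + n + m) (R := [])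
    readCmd rfl (σ := State.init w) (τ := State.init w) ⟨fun _ _ => rfl, rfl⟩ (by simp)
  obtain ⟨t₂, τ₂, r₂, l₂, h₂⟩ := simulated_of_wf (B := 2 ^ k + n + m) (R := [Reg.n, Reg.m, Reg.k])
    setupCmd rfl h₁ input_bounded
  obtain ⟨t₃, τ₃, r₃, l₃, h₃⟩ := simulated_of_wf (B := 2 ^ k + n + m)
    (R := [Reg.n, Reg.m, Reg.k, Reg.pow]) solveCmd rfl h₂ stores.bounded
  refine ⟨_, ⟨τ₃, .seq (.seq r₁ r₂) r₃, ?_⟩, add_le_add (add_le_add l₁ l₂) l₃⟩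
  rw [← answerCmd_spec (eliminateCmd_spec stores), State.output, State.output, h₃.1 1 (by decide),
    h₃.2]
  rfl

end Eliminate

end NestSetSearch

namespace RAM

theorem Prog.Computes.take_one {p : Prog} {x y : List ℕ} {t : ℕ} (h : p.Computes x t y)
    (hy : y ≠ []) : (Prog.seq p (.const 1 1)).Computes x (t + 1) (y.take 1) := by
  obtain ⟨τ, run, rfl⟩ := h
  have nonempty : 1 ≤ τ.reg 1 := Nat.one_le_iff_ne_zero.2 fun h => hy (by simp [State.output, h])
  exact ⟨τ.setReg 1 1, .seq run (.const 1 1 τ), NestSetSearch.output_setReg nonempty⟩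

end RAM

namespace NSWInstance

open Finset NestSetElimination NestSetSearch

section Numbering

variable (x : NSWInstance.{u})

/-- The set of the vertices with the numbers in `S`. -/
def toSet (S : Finset ℕ) : Set x.α := {v | ∃ i : Fin x.n, (i : ℕ) ∈ S ∧ v = x.vert i}

open Classical in
/-- The set of the numbers of the vertices in `s`. -/
noncomputable def indices (s : Set x.α) : Finset ℕ :=
  (univ.filter fun i : Fin x.n => (x.vert i : x.α) ∈ s).map Fin.valEmbedding

/-- The set of the numbers of the vertices of the edge with the number `e`. It is empty if there is
no such edge. -/
noncomputable def edgeIndices (e : ℕ) : Finset ℕ :=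
  if h : e < x.m then x.indices (x.edge ⟨e, h⟩) else ∅

variable {x} {D S T : Finset ℕ}

theorem vert_injective : Function.Injective fun i => (x.vert i : x.α) :=
  Subtype.val_injective.comp x.vert.injective

@[simp]
theorem vert_mem_toSet (i : Fin x.n) : (x.vert i : x.α) ∈ x.toSet S ↔ (i : ℕ) ∈ S :=
  ⟨fun ⟨_, hj, h⟩ => vert_injective h ▸ hj, fun h => ⟨i, h, rfl⟩⟩

@[simp]
theorem mem_indices {s : Set x.α} (i : Fin x.n) :
    (i : ℕ) ∈ x.indices s ↔ (x.vert i : x.α) ∈ s := by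
  simp [indices, Fin.val_inj]

theorem indices_subset (s : Set x.α) : x.indices s ⊆ range x.n := fun i hi => by
  obtain ⟨i, -, rfl⟩ := mem_map.1 hi
  exact mem_range.2 i.2

theorem edgeIndices_subset (e : ℕ) : x.edgeIndices e ⊆ range x.n := by
  rw [edgeIndices]
  split_ifs
  exacts [indices_subset _, empty_subset _]

theorem toSet_subset_iff (hS : S ⊆ range x.n) : x.toSet S ⊆ x.toSet T ↔ S ⊆ T := by
  refine ⟨fun h i hi => ?_, fun h v ⟨i, hi, hv⟩ => ⟨i, h hi, hv⟩⟩
  have hin := mem_range.1 (hS hi)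
  exact (vert_mem_toSet ⟨i, hin⟩).1 (h ((vert_mem_toSet ⟨i, hin⟩).2 hi))

theorem toSet_nonempty_iff (hS : S ⊆ range x.n) : (x.toSet S).Nonempty ↔ S.Nonempty :=
  ⟨fun ⟨_, i, hi, _⟩ => ⟨i, hi⟩, fun ⟨i, hi⟩ => ⟨_, ⟨i, mem_range.1 (hS hi)⟩, hi, rfl⟩⟩

theorem toSet_empty : x.toSet ∅ = ∅ := by simp [toSet]

theorem toSet_indices {s : Set x.α} (hs : s ⊆ x.H.vertexSet) : x.toSet (x.indices s) = s := by
  ext v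
  refine ⟨fun ⟨i, hi, hv⟩ => hv ▸ (mem_indices i).1 hi, fun hv => ?_⟩
  obtain ⟨i, hi⟩ := x.vert.surjective ⟨v, hs hv⟩
  exact ⟨i, (mem_indices i).2 (by rwa [hi]), by rw [hi]⟩

theorem toSet_range : x.toSet (range x.n) = x.H.vertexSet := by
  ext v
  refine ⟨fun ⟨i, _, hv⟩ => hv ▸ (x.vert i).2, fun hv => ?_⟩
  obtain ⟨i, hi⟩ := x.vert.surjective ⟨v, hv⟩
  exact ⟨i, mem_range.2 i.2, by rw [hi]⟩

theorem toSet_union : x.toSet (S ∪ T) = x.toSet S ∪ x.toSet T := by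
  ext v
  simp only [toSet, Finset.mem_union, Set.mem_ofPred_eq, Set.mem_union, or_and_right, exists_or]

theorem toSet_inter : x.toSet (S ∩ T) = x.toSet S ∩ x.toSet T := by
  ext v
  refine ⟨fun ⟨i, hi, hv⟩ => ?_, fun ⟨⟨i, hi, hv⟩, hT⟩ => ?_⟩
  · exact ⟨⟨i, (mem_inter.1 hi).1, hv⟩, ⟨i, (mem_inter.1 hi).2, hv⟩⟩
  · exact ⟨i, mem_inter.2 ⟨hi, (vert_mem_toSet i).1 (hv ▸ hT)⟩, hv⟩

theorem toSet_sdiff : x.toSet (S \ T) = x.toSet S \ x.toSet T := by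
  ext v
  refine ⟨fun ⟨i, hi, hv⟩ => ?_, fun ⟨⟨i, hi, hv⟩, hT⟩ => ?_⟩
  · exact ⟨⟨i, (mem_sdiff.1 hi).1, hv⟩,
      fun hT => (mem_sdiff.1 hi).2 ((vert_mem_toSet i).1 (hv ▸ hT))⟩
  · exact ⟨i, mem_sdiff.2 ⟨hi, fun h => hT (hv ▸ (vert_mem_toSet i).2 h)⟩, hv⟩

theorem encard_toSet (hS : S ⊆ range x.n) : (x.toSet S).encard = S.card := by
  have image : x.toSet S = (fun i => (x.vert i : x.α)) '' ((↑) ⁻¹' (S : Set ℕ)) := by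
    ext v
    simp [toSet, eq_comm]
  rw [image, vert_injective.encard_image, Set.encard_preimage_of_injective_subset_range
    Fin.val_injective, Set.encard_coe_eq_coe_finsetCard]
  exact fun i hi => ⟨⟨i, mem_range.1 (hS hi)⟩, rfl⟩

theorem forall_mem_edgeSet {P : Set x.α → Prop} :
    (∀ e ∈ x.H.edgeSet, P e) ↔ ∀ e < x.m, P (x.toSet (x.edgeIndices e)) := by
  have toSet_edgeIndices : ∀ e (he : e < x.m),
      x.toSet (x.edgeIndices e) = x.edge ⟨e, he⟩ := fun e he => by
    rw [edgeIndices, dif_pos he,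
      toSet_indices (x.H.subset_vertexSet_of_mem_edgeSet' (x.edge ⟨e, he⟩).2)]
  refine ⟨fun h e he => ?_, fun h e he => ?_⟩
  · rw [toSet_edgeIndices e he]
    exact h _ (x.edge ⟨e, he⟩).2
  · obtain ⟨i, hi⟩ := x.edge.surjective ⟨e, he⟩
    have := h i i.2
    rwa [toSet_edgeIndices i i.2, Fin.eta, hi] at this

theorem isNestSet_delete_toSet_iff (hS : S ⊆ range x.n) :
    (x.H.delete (x.toSet D)).IsNestSet (x.toSet S) ↔
      IsNest (remove x.edgeIndices D) (range x.n \ D) x.m S := by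
  rw [isNestSet_delete_iff, IsNest, toSet_nonempty_iff hS, ← toSet_range, ← toSet_sdiff,
    toSet_subset_iff hS]
  refine and_congr_right fun _ => and_congr_right fun hSD => ?_
  simp only [forall_mem_edgeSet, ← toSet_union, ← toSet_inter, ← toSet_sdiff,
    toSet_subset_iff (sdiff_subset.trans (edgeIndices_subset _)),
    toSet_nonempty_iff (inter_subset_right.trans hS)]
  refine forall₂_congr fun e _ => forall₂_congr fun f _ => ?_
  rw [incomparable_remove_iff (disjoint_sdiff.mono_right hSD)]
  tauto

end Numbering

section Presentation

variable (x : NSWInstance.{u})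

theorem size_eq : x.H.size = x.n + x.m := by
  rw [Hypergraph.size, ← Nat.card_coe_set_eq, ← Nat.card_coe_set_eq,
    Nat.card_eq_of_equiv_fin x.vert.symm, Nat.card_eq_of_equiv_fin x.edge.symm]

theorem mul_add_div_of_lt {a b c : ℕ} (h : c < b) : (a * b + c) / b = a := by
  rw [Nat.mul_comm, Nat.mul_add_div (by omega), Nat.div_eq_of_lt h, add_zero]

theorem encode_eq : x.encode = [x.k, x.n, x.m] ++ x.charVec x.H.vertexSet ++
    List.ofFn fun p : Fin (x.m * x.n) =>
      if (p : ℕ) % x.n ∈ x.edgeIndices (p / x.n) then 1 else 0 := by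
  rw [encode, List.ofFn_mul]
  congr! 5 with e
  refine congrArg List.ofFn (funext fun v => ?_)
  rw [mul_add_div_of_lt v.2, Nat.mul_add_mod_of_lt v.2, edgeIndices, dif_pos e.2]
  classical exact if_congr (mem_indices v).symm rfl rfl

theorem encodes : Encodes x.edgeIndices x.n x.m x.k x.encode where
  subset := edgeIndices_subset
  param := rfl
  card_vertices := rfl
  card_edges := rfl
  edge e he v hv := by
    have length : ([x.k, x.n, x.m] ++ x.charVec x.H.vertexSet).length = x.n + 3 := by
      simp [charVec]
    have lt : e * x.n + v < x.m * x.n := by nlinarith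
    rw [encode_eq, add_assoc, List.getD_append_right _ _ _ _ (by omega), length,
      Nat.add_sub_cancel_left, List.getD_eq_getElem _ _ (by simpa)]
    simp [mul_add_div_of_lt hv, Nat.mod_eq_of_lt hv]

theorem vertexSet_eq_empty (hn : x.n = 0) : x.H.vertexSet = ∅ := by
  rw [← toSet_range, hn, range_zero, toSet_empty]

theorem size_lt_length : x.n + x.m < x.encode.length := by
  have length : x.encode.length = x.n + 3 + x.m * x.n := by
    simp [encode_eq, charVec]
    omega
  rcases Nat.eq_zero_or_pos x.n with hn | hn
  · have edge_eq : ∀ e, (x.edge e : Set x.α) = ∅ := fun e =>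
      Set.subset_empty_iff.1 (x.vertexSet_eq_empty hn ▸
        x.H.subset_vertexSet_of_mem_edgeSet' (x.edge e).2)
    have : Subsingleton (Fin x.m) := ⟨fun e f =>
      x.edge.injective (Subtype.ext ((edge_eq e).trans (edge_eq f).symm))⟩
    have := Fin.subsingleton_iff_le_one.1 this
    omega
  · have := Nat.le_mul_of_pos_right x.m hn
    omega

variable {x}

theorem represents_code (O : List (Finset ℕ)) :
    x.Represents (code x.n O) (O.reverse.map x.toSet) := by
  refine ⟨O.reverse.map fun S => (List.finRange x.n).filter fun i => (i : ℕ) ∈ S, ?_, ?_⟩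
  · rw [List.map_map]
    refine congrArg List.flatten (List.map_congr_left fun S _ => ?_)
    rw [codeSet, ← List.map_coe_finRange_eq_range, List.filter_map]
    simp only [Function.comp_apply, Function.comp_def, List.bind_eq_flatMap, List.pure_def,
      ← List.map_eq_flatMap]
  · rw [List.map_map]
    refine List.map_congr_left fun S _ => Set.ext fun v => ?_
    simp [toSet]

end Presentation

section Elimination

variable {x : NSWInstance.{u}} {O : List (Finset ℕ)}

theorem isNEO_append {k : ℕ} (hO : IsElimination x.edgeIndices (range x.n) x.m k O)
    {P : List (Set x.α)} (hP : (x.H.delete (x.toSet (NestSetSearch.deleted O))).IsNEO P) :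
    (x.H.delete ∅).IsNEO (O.reverse.map x.toSet ++ P) := by
  induction O generalizing P with
  | nil => rwa [NestSetSearch.deleted, List.foldr_nil, toSet_empty] at hP
  | cons S O ih =>
    rw [List.reverse_cons, List.map_append, List.append_assoc]
    refine ih hO.2.2 ⟨(isNestSet_delete_toSet_iff (hO.1.2.1.trans sdiff_subset)).2 hO.1, ?_⟩
    rwa [delete_delete, ← toSet_union, union_comm]

theorem isKNEO_of_isElimination {k : ℕ}
    (hO : IsElimination x.edgeIndices (range x.n) x.m k O)
    (hall : NestSetSearch.deleted O = range x.n) (hmn : x.m ≠ 0 → x.n ≠ 0) :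
    x.H.IsKNEO k (O.reverse.map x.toSet) := by
  refine ⟨?_, fun s hs => ?_⟩
  · rcases eq_or_ne O [] with rfl | hne
    · have hn : x.n = 0 := (range_eq_empty_iff).1 hall.symm
      have hm : x.m = 0 := not_ne_iff.1 fun hm => hmn hm hn
      refine Hypergraph.ext (x.vertexSet_eq_empty hn) (Set.eq_empty_iff_forall_notMem.2 ?_)
      exact forall_mem_edgeSet.2 fun e he => absurd he (hm ▸ Nat.not_lt_zero e)
    · refine isNEO_of_delete_empty (by simpa using hne) ?_
      rw [← List.append_nil (O.reverse.map x.toSet)]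
      refine isNEO_append hO (delete_eq_bot ?_)
      rw [hall, toSet_range]
  · obtain ⟨S, hS, rfl⟩ := List.mem_map.1 hs
    have := hO.subset S (List.mem_reverse.1 hS)
    rw [encard_toSet this.1]
    exact_mod_cast this.2

theorem not_nsw_le_of_stuck (hO : Stuck x.edgeIndices (range x.n) x.m x.k O)
    (hall : ¬ range x.n ⊆ NestSetSearch.deleted O) : ¬ x.H.nsw ≤ x.k := by
  rw [nsw_le_iff]
  rintro ⟨P, hP⟩
  have remaining : (x.H.vertexSet \ x.toSet (NestSetSearch.deleted O)).Nonempty := by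
    rwa [Set.sdiff_nonempty, ← toSet_range, toSet_subset_iff subset_rfl]
  obtain ⟨s, hs, hk⟩ := exists_isNestSet_delete hP remaining
  have toSet_eq := toSet_indices (hs.2.1.trans Set.sdiff_subset)
  rw [← toSet_eq, isNestSet_delete_toSet_iff (indices_subset s)] at hs
  rw [← toSet_eq, encard_toSet (indices_subset s)] at hk
  exact (hO _ hs).not_ge (by exact_mod_cast hk)

theorem not_nsw_le_of_n_eq_zero {k : ℕ} (hn : x.n = 0) (hm : x.m ≠ 0) : ¬ x.H.nsw ≤ k := by
  rw [nsw_le_iff]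
  rintro ⟨_ | ⟨s, P⟩, hP, -⟩
  · have edge_mem := (x.edge ⟨0, Nat.pos_of_ne_zero hm⟩).2
    exact Set.notMem_empty _ ((congrArg Hypergraph.edgeSet (show x.H = ⊥ from hP)).subset edge_mem)
  · have subset_empty := hP.1.2.1
    rw [x.vertexSet_eq_empty hn] at subset_empty
    exact hP.1.1.not_subset_empty subset_empty

end Elimination

section Answer

variable {x : NSWInstance.{u}}

/-- `y` is a correct output on the instance `x = (H, k)`: it is `1`, followed by a description of a
`k`-NEO, if `nsw H ≤ k`, and `0` otherwise. -/
def IsAnswer (x : NSWInstance.{u}) (y : List ℕ) : Prop :=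
  (x.H.nsw ≤ (x.k : ℕ∞) →
    ∃ (w : List ℕ) (O : List (Set x.α)), y = 1 :: w ∧ x.Represents w O ∧ x.H.IsKNEO x.k O) ∧
  (¬ x.H.nsw ≤ (x.k : ℕ∞) → y = [0])

theorem isAnswer_eliminate (x : NSWInstance.{u}) {O : List (Finset ℕ)}
    (hO : eliminate x.edgeIndices x.m x.k (List.range x.n) = O) :
    x.IsAnswer (if NestSetSearch.deleted O = range x.n ∧ (x.m ≠ 0 → x.n ≠ 0)
      then 1 :: code x.n O else [0]) := by
  have edges_subset : ∀ e, x.edgeIndices e ⊆ (List.range x.n).toFinset := fun e => by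
    rw [List.toFinset_range]
    exact edgeIndices_subset e
  have elimination := isElimination_eliminate (m := x.m) (k := x.k) edges_subset
  have stuck_or := eliminate_stuck_or (m := x.m) (k := x.k) edges_subset
  rw [List.toFinset_range, hO] at elimination stuck_or
  split_ifs with accept
  · have neo := isKNEO_of_isElimination elimination accept.1 accept.2
    exact ⟨fun _ => ⟨_, _, rfl, represents_code O, neo⟩,
      fun reject => absurd (nsw_le_iff.2 ⟨_, neo⟩) reject⟩
  · refine ⟨fun yes => absurd yes ?_, fun _ => rfl⟩
    by_cases hall : NestSetSearch.deleted O = range x.n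
    · obtain ⟨hm, hn⟩ := Classical.not_imp.1 (not_and.1 accept hall)
      exact not_nsw_le_of_n_eq_zero (not_ne_iff.1 hn) hm
    · exact not_nsw_le_of_stuck (stuck_or.resolve_right hall)
        fun h => hall (elimination.deleted_subset.antisymm h)

theorem IsAnswer.ne_nil {y : List ℕ} (h : x.IsAnswer y) : y ≠ [] := by
  by_cases yes : x.H.nsw ≤ (x.k : ℕ∞)
  · obtain ⟨w, O, rfl, -⟩ := h.1 yes
    exact List.cons_ne_nil 1 w
  · exact h.2 yes ▸ List.cons_ne_nil 0 []

theorem exists_computes_isAnswer : ∃ (p : RAM.Prog) (c : ℕ), ∀ x : NSWInstance.{u},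
    ∃ (t : ℕ) (y : List ℕ), p.Computes x.encode t y ∧
      t ≤ c * 2 ^ (c * x.k) * (x.H.size + 1) ^ c ∧ x.IsAnswer y := by
  obtain ⟨c, hc⟩ := (ForLang.Cmd.polyBounded_cost algorithm).exists_le_two_pow_mul
  refine ⟨algorithm.compile Reg.scratch, c, fun x => ?_⟩
  obtain ⟨t, computes, time⟩ := exists_computes x.encodes
  refine ⟨t, _, computes, time.trans ?_, x.isAnswer_eliminate rfl⟩
  rw [size_eq, add_assoc]
  exact hc x.k (x.n + x.m)

end Answer

end NSWInstance

theorem isFPT_nswProblem : NSWProblem.{u}.IsFPT := by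
  obtain ⟨p, c, hp⟩ := NSWInstance.exists_computes_isAnswer.{u}
  refine ⟨.seq p (.const 1 1), fun k => (c + 1) * 2 ^ (c * k), c, ?_, fun x => ?_⟩
  · have two_pow : Primrec fun n : ℕ => 2 ^ n :=
      (Primrec₂.unpaired'.1 Nat.Primrec.pow).comp (Primrec.const 2) Primrec.id
    exact (Primrec.nat_mul.comp (Primrec.const (c + 1))
      (two_pow.comp (Primrec.nat_mul.comp (Primrec.const c) Primrec.id))).to_comp
  · obtain ⟨t, y, computes, time, answer⟩ := hp x
    refine ⟨t + 1, y.take 1, computes.take_one answer.ne_nil, ?_, fun yes => ?_, fun no => ?_⟩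
    · have size_lt : x.H.size + 1 ≤ x.encode.length := x.size_eq ▸ x.size_lt_length
      have one_le : 1 ≤ 2 ^ (c * x.k) * x.encode.length ^ c :=
        Nat.mul_pos (Nat.two_pow_pos _) (Nat.pow_pos (by omega))
      calc t + 1 ≤ c * 2 ^ (c * x.k) * x.encode.length ^ c +
            2 ^ (c * x.k) * x.encode.length ^ c :=
            add_le_add (time.trans (by gcongr)) one_le
        _ = (c + 1) * 2 ^ (c * x.k) * x.encode.length ^ c := by ring
    · obtain ⟨w, O, rfl, -⟩ := answer.1 yes
      rfl
    · rw [answer.2 no]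
      rfl

theorem corollary5p7_general :
    NSWProblem.{u}.IsFPT ∧
    ∃ (p : RAM.Prog) (c : ℕ), ∀ x : NSWInstance.{u}, ∃ (t : ℕ) (y : List ℕ),
      p.Computes x.encode t y ∧ t ≤ c * 2 ^ (c * x.k) * (x.H.size + 1) ^ c ∧ x.IsAnswer y :=
  ⟨isFPT_nswProblem, NSWInstance.exists_computes_isAnswer⟩

/-- Deciding `nsw H ≤ k` is fixed-parameter tractable in `k`; moreover, a program running in time
`2 ^ O(k ^ 2) * poly ‖H‖` outputs a `k`-NEO of `H` if `nsw H ≤ k`, and rejects otherwise. -/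
theorem corollary5p7 :
    NSWProblem.{u}.IsFPT ∧
    ∃ (p : RAM.Prog) (c : ℕ), ∀ x : NSWInstance.{u}, ∃ (t : ℕ) (y : List ℕ),
      p.Computes x.encode t y ∧
      t ≤ c * 2 ^ (c * x.k ^ 2) * (x.H.size + 1) ^ c ∧
      (x.H.nsw ≤ (x.k : ℕ∞) →
        ∃ (w : List ℕ) (O : List (Set x.α)),
          y = 1 :: w ∧ x.Represents w O ∧ x.H.IsKNEO x.k O) ∧
      (¬ x.H.nsw ≤ (x.k : ℕ∞) → y = [0]) := by
  obtain ⟨fpt, p, c, hp⟩ := corollary5p7_general.{u}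
  refine ⟨fpt, p, c, fun x => ?_⟩
  obtain ⟨t, y, computes, time, answer⟩ := hp x
  refine ⟨t, y, computes, time.trans ?_, answer⟩
  gcongr
  exacts [one_le_two, Nat.le_self_pow two_ne_zero _]
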